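/- Let $K$ be a field of characteristic $0$, let $n, r, s$ be positive integers such that $s$ is a multiple of $r$, and let $R = K[x_1,\dots,x_n]$ be the polynomial ring with its standard grading. Let $e_i$ denote the elementary symmetric polynomial of degree $i$ in $n$ variables, and put $$f_i = e_i(x_1^r,\dots,x_n^r)\quad (1\le i\le n-1),\qquad f_n = e_n(x_1^s,\dots,x_n^s).$$ Then $f_1,\dots,f_n$ is a regular sequence in $R$, so that $A = R/(f_1,\dots,f_n)$ is a graded Artinian complete intersection (in particular a finite-dimensional $K$-algebra), and $A$ has the Strong Lefschetz Property: writing $A=\bigoplus_{i=0}^c A_i$ with $A_c\neq 0$, there exists a linear form $g\in A_1$ such that multiplication by $g^{c-2i}$ is a bijection $A_i\to A_{c-i}$ for all $i = 0,1,\dots,\lfloor c/2\rfloor$. -/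

import Mathlib

/-- The family of homogeneous pieces of a quotient `R / I` of the polynomial ring
`R = K[x_1, …, x_n]` (each variable of degree one): the `d`-th piece is the image of the space of
forms of degree `d`. For a homogeneous ideal `I` this is the standard grading of `R / I`. -/
noncomputable def quotientGrading {K : Type*} [Field K] {n : ℕ}
    (I : Ideal (MvPolynomial (Fin n) K)) (d : ℕ) : Submodule K (MvPolynomial (Fin n) K ⧸ I) :=
  (MvPolynomial.homogeneousSubmodule (Fin n) K d).map (Ideal.Quotient.mkₐ K I).toLinearMap

/-- The Strong Lefschetz Property of an Artinian algebra `A` graded by the pieces `𝒜 0, 𝒜 1, …`: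
if `c` is the largest degree with `𝒜 c ≠ 0`, then there is a linear form `g` such that multiplication
by `g ^ (c - 2 * i)` is a bijection from `𝒜 i` onto `𝒜 (c - i)` for all `i ≤ c / 2`. -/
def HasSLP {K A : Type*} [Field K] [CommRing A] [Algebra K A] (𝒜 : ℕ → Submodule K A) : Prop :=
  ∃ c : ℕ, 𝒜 c ≠ ⊥ ∧ (∀ d, c < d → 𝒜 d = ⊥) ∧
    ∃ g ∈ 𝒜 1, ∀ i, 2 * i ≤ c →
      Set.BijOn (fun a => g ^ (c - 2 * i) * a) (𝒜 i : Set A) (𝒜 (c - i) : Set A)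

/-- The polynomials `f_1, …, f_n` (indexed from zero, so `i : Fin n` stands for `f_{i+1}`):
`f_j = e_j(x_1^r, …, x_n^r)` for `j < n`, and `f_n = e_n(x_1^s, …, x_n^s)`. -/
noncomputable def esymmOfPowers (K : Type*) [Field K] (n r s : ℕ) (i : Fin n) :
    MvPolynomial (Fin n) K :=
  if (i : ℕ) + 1 < n then
    MvPolynomial.aeval (fun j => MvPolynomial.X j ^ r) (MvPolynomial.esymm (Fin n) K (i + 1))
  else
    MvPolynomial.aeval (fun j => MvPolynomial.X j ^ s) (MvPolynomial.esymm (Fin n) K n)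

/-!
The quotient `A = K[x] / (f_1, …, f_n)` has the strong Lefschetz property because it is a flat
deformation of a monomial complete intersection, for which the property comes from an action of
`sl₂`. Write `s = r m`, and index the variables from zero as `x_0, …, x_{n-1}`.

*Freeness.* Over any ring `S`, the algebra `S[x] / (e_k (x_0 ^ r, …, x_{n-1} ^ r) - c_k)_k` is free
of rank `r ^ n n!` (`nonempty_basis_of_ker_aeval_eq`): the first variable is a root of a monic
polynomial of degree `r n`, and over the ring it generates the remaining variables solve the same
problem. With `S = K[y_1, …, y_n]` and `c_k = y_k`, this says that `K[x]` is free over `K[y]`, with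
`y_k` acting as `e_k (x ^ r)`; hence the regular sequence `y_1, …, y_{n-1}, y_n ^ m` stays regular,
and it is mapped to the `f_k`. With `S = K[t] / (t ^ m)` and `c = (0, …, 0, t)`, the algebra is `A`,
so that `dim A = m r ^ n n!`.

*Leading monomials.* Modulo the `f_k`, the complete symmetric function of degree `k + 1` in
`x_k ^ r, …, x_{n-1} ^ r` vanishes for `k < n - 1`, and for `k = n - 1` its `m`-th power does
(`sum_finsuppAntidiag_prod_pow_eq`). Thus the ideal contains forms with leading monomials
`x_k ^ N_k`, where the exponents `N_k` satisfy `∏ N_k = dim A` (`exists_X_pow_add_mem`). Scaling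
`x_i` by `μ ^ i` deforms these forms to `x_k ^ N_k` at `μ = 0`. As spanning is an open condition in
`μ` (`exists_forall_homogeneousSubmodule_le`), the monomials `x ^ a` with `a_k < N_k` span `A`, so
by their number they form a basis and the Hilbert function of `A` is that of
`K[x] / (x_k ^ N_k)`, in particular symmetric. By the same openness, if powers of `∑ x_k` are
surjective between complementary degrees of `K[x] / (x_k ^ N_k)`, then powers of a rescaled sum
`∑ μ ^ (-i) x_i` are surjective on `A`, and by symmetry of the Hilbert function they are bijective.

*The monomial case.* On `K[x] / (x_k ^ N_k)`, multiplication by `∑ x_k` and the operator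
`∑ ((N_k - 1) ∂_k - x_k ∂_k²)` generate an action of `sl₂` for which a form of degree `d` has weight
`2 d - ∑ (N_k - 1)`; the surjectivity follows from `sl2_eq_zero_of_pow_apply_eq_zero`
(`exists_sub_sum_X_pow_mul_mem`).
-/

/-! ### `sl₂`-representations -/

/-- Let `e, f, h` be an `sl₂`-triple of operators with `f` locally nilpotent. A vector of integral
weight `m` killed by `e ^ j` vanishes if `m ≤ -j`. The Casimir operator forces such a vector,
by induction on `j`, to be an eigenvector of `e * f` on its whole `f`-string, with nonzero
eigenvalues, contradicting nilpotence of `f`. -/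
theorem sl2_eq_zero_of_pow_apply_eq_zero {K V : Type*} [Field K] [CharZero K] [AddCommGroup V]
    [Module K V] {e f h : Module.End K V} (hef : e * f - f * e = h)
    (hhe : h * e - e * h = 2 • e) (hhf : h * f - f * h = -(2 • f))
    (hf : ∀ v, ∃ k, (f ^ k) v = 0) (j : ℕ) :
    ∀ (m : ℤ) (v : V), h v = (m : K) • v → (e ^ j) v = 0 → m ≤ -j → v = 0 := by
  have ef (v : V) : e (f v) = f (e v) + h v := by
    have := LinearMap.congr_fun hef v
    simp only [LinearMap.sub_apply, Module.End.mul_apply] at this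
    rw [← this]; abel
  have he (v : V) : h (e v) = e (h v) + (2 : K) • e v := by
    have := LinearMap.congr_fun hhe v
    simp only [LinearMap.sub_apply, Module.End.mul_apply, LinearMap.smul_apply] at this
    rw [ofNat_smul_eq_nsmul K 2, ← this]; abel
  have hfv (v : V) : h (f v) = f (h v) - (2 : K) • f v := by
    have := LinearMap.congr_fun hhf v
    simp only [LinearMap.sub_apply, Module.End.mul_apply, LinearMap.smul_apply,
      LinearMap.neg_apply] at this
    rw [ofNat_smul_eq_nsmul K 2, sub_eq_add_neg, ← this]; abel
  have wte (m : ℤ) (v : V) (hv : h v = (m : K) • v) (i : ℕ) :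
      h ((e ^ i) v) = ((m + 2 * i : ℤ) : K) • (e ^ i) v := by
    induction i with
    | zero => simpa using hv
    | succ i ih =>
      rw [pow_succ', Module.End.mul_apply, he, ih, map_smul, ← add_smul]
      congr 1; push_cast; ring
  have wtf (m : ℤ) (v : V) (hv : h v = (m : K) • v) (i : ℕ) :
      h ((f ^ i) v) = ((m - 2 * i : ℤ) : K) • (f ^ i) v := by
    induction i with
    | zero => simpa using hv
    | succ i ih =>
      rw [pow_succ', Module.End.mul_apply, hfv, ih, map_smul, ← sub_smul]
      congr 1; push_cast; ring
  -- the Casimir operator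
  let C : Module.End K V := (4 : K) • (f * e) + h * h + (2 : K) • h
  have C_apply (v : V) : C v = (4 : K) • f (e v) + h (h v) + (2 : K) • h v := rfl
  have Ce (v : V) : C (e v) = e (C v) := by
    simp only [C_apply, he, ef, map_add, map_smul]
    module
  have Cf (v : V) : C (f v) = f (C v) := by
    simp only [C_apply, hfv, ef, map_add, map_smul, map_sub]
    module
  have Cei (i : ℕ) (v : V) : C ((e ^ i) v) = (e ^ i) (C v) := by
    induction i with
    | zero => rfl
    | succ i ih => rw [pow_succ', Module.End.mul_apply, Ce, ih, Module.End.mul_apply]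
  have Cfi (i : ℕ) (v : V) : C ((f ^ i) v) = (f ^ i) (C v) := by
    induction i with
    | zero => rfl
    | succ i ih => rw [pow_succ', Module.End.mul_apply, Cf, ih, Module.End.mul_apply]
  induction j with
  | zero => intro m v _ h0 _; simpa using h0
  | succ j ih =>
    intro m v hv hz hm
    push_cast at hm
    have hz' : e ((e ^ j) v) = 0 := by rwa [pow_succ', Module.End.mul_apply] at hz
    let c : ℤ := (m + 2 * j) * (m + 2 * j + 2)
    -- `v` has the Casimir eigenvalue of the highest weight vector `e ^ j v`
    have hC : C v = (c : K) • v := by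
      rw [← sub_eq_zero]
      refine ih m _ ?_ ?_ (by lia)
      · have h1 := wte m v hv 1
        have h2 := wtf _ _ h1 1
        simp only [pow_one] at h1 h2
        simp only [C_apply, map_add, map_sub, map_smul, h2, hv]
        push_cast
        module
      · rw [map_sub, ← Cei, map_smul, C_apply, hz',
          wte m v hv j, map_smul, wte m v hv j, map_zero, smul_zero]
        simp only [c]
        push_cast
        module
    -- `4 e f` acts on `f ^ i v` as `c - (m - 2 i) (m - 2 i - 2) = 4 (i + j + 1) (m + j - i)`, which is
    -- nonzero because `m + j < 0`
    have step (i : ℕ) (hi : (f ^ (i + 1)) v = 0) : (f ^ i) v = 0 := by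
      have h1 : C ((f ^ i) v) = (c : K) • (f ^ i) v := by rw [Cfi, hC, map_smul]
      have h2 := ef ((f ^ i) v)
      rw [pow_succ', Module.End.mul_apply] at hi
      rw [hi, map_zero] at h2
      rw [C_apply, eq_neg_of_add_eq_zero_left h2.symm, wtf m v hv i, map_smul, wtf m v hv i] at h1
      have h3 : ((4 * ((i + j + 1) * (m + j - i)) : ℤ) : K) • (f ^ i) v = 0 := by
        rw [← sub_eq_zero] at h1
        rw [← neg_eq_zero, ← h1]
        simp only [c]
        push_cast
        module
      refine (smul_eq_zero.1 h3).resolve_left (Int.cast_ne_zero.2 ?_)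
      refine mul_ne_zero (by norm_num) (mul_ne_zero (by lia) (by lia))
    obtain ⟨k, hk⟩ := hf v
    induction k with
    | zero => simpa using hk
    | succ k ihk => exact ihk (step k hk)

/-- The counterpart of `sl2_eq_zero_of_pow_apply_eq_zero` for the lowering operator. -/
theorem sl2_eq_zero_of_pow_apply_eq_zero' {K V : Type*} [Field K] [CharZero K] [AddCommGroup V]
    [Module K V] {e f h : Module.End K V} (hef : e * f - f * e = h)
    (hhe : h * e - e * h = 2 • e) (hhf : h * f - f * h = -(2 • f))
    (he : ∀ v, ∃ k, (e ^ k) v = 0) (j : ℕ) (m : ℤ) (v : V) (hv : h v = (m : K) • v)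
    (hz : (f ^ j) v = 0) (hm : (j : ℤ) ≤ m) : v = 0 := by
  refine sl2_eq_zero_of_pow_apply_eq_zero (e := f) (f := e) (h := -h) ?_ ?_ ?_ he j (-m) v ?_ hz
    (by lia)
  · rw [← hef]; abel
  · rw [neg_mul, mul_neg, sub_neg_eq_add, neg_add_eq_sub, ← neg_sub, hhf, neg_neg]
  · rw [neg_mul, mul_neg, sub_neg_eq_add, neg_add_eq_sub, ← neg_sub, hhe]
  · rw [LinearMap.neg_apply, hv, Int.cast_neg, neg_smul]

/-! ### Monomial complete intersections -/

section MonomialCompleteIntersection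

open MvPolynomial

variable {K σ : Type*} [Field K]

/-- The ideal of a monomial complete intersection, generated by the powers `x_k ^ N_k` for `k` in
`s`, is described by exponents. -/
theorem mem_span_X_pow_image_iff (N : σ → ℕ) (s : Set σ) (g : MvPolynomial σ K) :
    g ∈ Ideal.span ((fun k => (X k : MvPolynomial σ K) ^ N k) '' s) ↔
      ∀ b ∈ g.support, ∃ k ∈ s, N k ≤ b k := by
  have : (fun k => (X k : MvPolynomial σ K) ^ N k) '' s =
      (fun a => monomial a 1) '' ((fun k => Finsupp.single k (N k)) '' s) := by
    rw [Set.image_image]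
    simp only [X_pow_eq_monomial]
  rw [this, mem_ideal_span_monomial_image]
  simp only [Set.exists_mem_image, Finsupp.single_le_iff]

theorem mem_span_range_X_pow_iff (N : σ → ℕ) (g : MvPolynomial σ K) :
    g ∈ Ideal.span (Set.range fun k => (X k : MvPolynomial σ K) ^ N k) ↔
      ∀ b ∈ g.support, ∃ k, N k ≤ b k := by
  rw [← Set.image_univ, mem_span_X_pow_image_iff]
  simp

theorem degree_eq_of_mem_support {d : ℕ} {g : MvPolynomial σ K} (hg : g.IsHomogeneous d)
    {b : σ →₀ ℕ} (hb : b ∈ g.support) : b.degree = d := by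
  rw [Finsupp.degree_eq_weight_one]
  exact hg (mem_support_iff.1 hb)

variable [Fintype σ]

/-- A form of degree larger than `∑ (N_k - 1)` lies in the ideal `(x_k ^ N_k)`. -/
theorem mem_span_range_X_pow_of_lt {N : σ → ℕ} {d : ℕ} {g : MvPolynomial σ K}
    (hg : g.IsHomogeneous d) (hd : ∑ k, (N k - 1) < d) :
    g ∈ Ideal.span (Set.range fun k => (X k : MvPolynomial σ K) ^ N k) := by
  rw [mem_span_range_X_pow_iff]
  intro b hb
  by_contra! hlt
  have h1 := degree_eq_of_mem_support hg hb
  rw [Finsupp.degree_eq_sum] at h1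
  have : ∑ k, b k ≤ ∑ k, (N k - 1) := Finset.sum_le_sum fun k _ => Nat.le_sub_one_of_lt (hlt k)
  lia

/-- The lowering operator `∑ ((N_k - 1) ∂_k - x_k ∂_k²)` of the `sl₂`-action on
`K[x] / (x_k ^ N_k)`; it sends `x_k ^ a` to `a (N_k - a) x_k ^ (a - 1)`. -/
noncomputable def loweringOp (K : Type*) {σ : Type*} [Field K] [Fintype σ] (N : σ → ℕ) :
    Module.End K (MvPolynomial σ K) :=
  ∑ k, (((N k : K) - 1) • (pderiv k).toLinearMap -
    LinearMap.mulLeft K (X k) ∘ₗ (pderiv k).toLinearMap ∘ₗ (pderiv k).toLinearMap)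

/-- The Euler operator `∑ x_k ∂_k`. -/
noncomputable def eulerOp (K σ : Type*) [Field K] [Fintype σ] : Module.End K (MvPolynomial σ K) :=
  ∑ k, LinearMap.mulLeft K (X k) ∘ₗ (pderiv k).toLinearMap

theorem loweringOp_apply (N : σ → ℕ) (g : MvPolynomial σ K) :
    loweringOp K N g =
      ∑ k, (C ((N k : K) - 1) * pderiv k g - X k * pderiv k (pderiv k g)) := by
  simp [loweringOp, LinearMap.sum_apply, smul_eq_C_mul]

theorem eulerOp_apply (g : MvPolynomial σ K) : eulerOp K σ g = ∑ k, X k * pderiv k g := by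
  simp [eulerOp, LinearMap.sum_apply]

theorem eulerOp_of_isHomogeneous {d : ℕ} {g : MvPolynomial σ K} (hg : g.IsHomogeneous d) :
    eulerOp K σ g = (d : K) • g := by
  rw [eulerOp_apply, hg.sum_X_mul_pderiv, Nat.cast_smul_eq_nsmul]

theorem pderiv_sum_X (k : σ) : pderiv k (∑ i, (X i : MvPolynomial σ K)) = 1 := by
  classical
  simp [map_sum, pderiv_X, Pi.single_apply]

/-- The commutator of multiplication by `∑ x_k` with the lowering operator. -/
theorem loweringOp_sum_X_mul (N : σ → ℕ) (g : MvPolynomial σ K) :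
    loweringOp K N ((∑ i, X i) * g) = (∑ i, X i) * loweringOp K N g -
      ((2 : K) • eulerOp K σ g - (∑ k, ((N k : K) - 1)) • g) := by
  simp only [loweringOp_apply, eulerOp_apply, pderiv_mul, pderiv_sum_X, map_add, Finset.smul_sum,
    Finset.mul_sum, Finset.sum_smul, ← Finset.sum_sub_distrib, one_mul, smul_eq_C_mul]
  refine Finset.sum_congr rfl fun k _ => ?_
  rw [show (C (2 : K) : MvPolynomial σ K) = 2 from map_ofNat _ 2]
  ring

theorem eulerOp_sum_X_mul (g : MvPolynomial σ K) :
    eulerOp K σ ((∑ i, X i) * g) = (∑ i, X i) * eulerOp K σ g + (∑ i, X i) * g := by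
  rw [eulerOp_apply, eulerOp_apply]
  simp only [pderiv_mul, pderiv_sum_X, one_mul]
  rw [Finset.mul_sum, Finset.sum_mul, ← Finset.sum_add_distrib]
  exact Finset.sum_congr rfl fun k _ => by ring

theorem isHomogeneous_loweringOp (N : σ → ℕ) {d : ℕ} {g : MvPolynomial σ K}
    (hg : g.IsHomogeneous (d + 1)) : (loweringOp K N g).IsHomogeneous d := by
  rw [loweringOp_apply]
  refine IsHomogeneous.sum _ _ _ fun k _ => ?_
  have h1 : (pderiv k g).IsHomogeneous d := hg.pderiv
  refine IsHomogeneous.sub ?_ ?_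
  · simpa using (isHomogeneous_C σ ((N k : K) - 1)).mul h1
  · cases d with
    | zero =>
      rw [← totalDegree_zero_iff_isHomogeneous, totalDegree_eq_zero_iff_eq_C] at h1
      rw [h1, pderiv_C, mul_zero]
      exact isHomogeneous_zero _ _ _
    | succ d => simpa [add_comm] using (isHomogeneous_X K k).mul h1.pderiv

theorem loweringOp_of_isHomogeneous_zero (N : σ → ℕ) {g : MvPolynomial σ K}
    (hg : g.IsHomogeneous 0) : loweringOp K N g = 0 := by
  rw [← totalDegree_zero_iff_isHomogeneous, totalDegree_eq_zero_iff_eq_C] at hg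
  rw [loweringOp_apply, hg]
  simp

theorem isHomogeneous_loweringOp_pow (N : σ → ℕ) {d : ℕ} (i : ℕ) {g : MvPolynomial σ K}
    (hg : g.IsHomogeneous (d + i)) : ((loweringOp K N ^ i) g).IsHomogeneous d := by
  induction i generalizing g with
  | zero => simpa using hg
  | succ i ih =>
    rw [pow_succ, Module.End.mul_apply]
    exact ih (isHomogeneous_loweringOp N hg)

theorem exists_loweringOp_pow_apply_eq_zero (N : σ → ℕ) (g : MvPolynomial σ K) :
    ∃ k, (loweringOp K N ^ k) g = 0 := by
  induction g using MvPolynomial.induction_on' with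
  | monomial a c =>
    refine ⟨a.degree + 1, ?_⟩
    rw [pow_succ', Module.End.mul_apply]
    refine loweringOp_of_isHomogeneous_zero N (isHomogeneous_loweringOp_pow N _ ?_)
    rw [zero_add]
    exact isHomogeneous_monomial c rfl
  | add p q hp hq =>
    obtain ⟨k, hk⟩ := hp
    obtain ⟨l, hl⟩ := hq
    exact ⟨max k l, by rw [map_add, Module.End.pow_map_zero_of_le (le_max_left k l) hk,
      Module.End.pow_map_zero_of_le (le_max_right k l) hl, add_zero]⟩

theorem eulerOp_loweringOp (N : σ → ℕ) (g : MvPolynomial σ K) :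
    eulerOp K σ (loweringOp K N g) = loweringOp K N (eulerOp K σ g) - loweringOp K N g := by
  induction g using MvPolynomial.induction_on' with
  | monomial a c =>
    have ha : (monomial a c).IsHomogeneous a.degree := isHomogeneous_monomial c rfl
    rw [eulerOp_of_isHomogeneous ha, map_smul]
    rcases hd : a.degree with _ | d
    · rw [hd] at ha
      rw [loweringOp_of_isHomogeneous_zero N ha]
      simp
    · rw [hd] at ha
      rw [eulerOp_of_isHomogeneous (isHomogeneous_loweringOp N ha)]
      push_cast
      module
  | add p q hp hq =>
    simp only [map_add, hp, hq]
    abel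

/-- The lowering operator preserves the ideal `(x_k ^ N_k)`: the terms in `x_k ^ (N_k - 1)`
cancel. -/
theorem loweringOp_mem {N : σ → ℕ} (hN : ∀ k, 0 < N k) {g : MvPolynomial σ K}
    (hg : g ∈ Ideal.span (Set.range fun k => (X k : MvPolynomial σ K) ^ N k)) :
    loweringOp K N g ∈ Ideal.span (Set.range fun k => (X k : MvPolynomial σ K) ^ N k) := by
  classical
  obtain ⟨a, rfl⟩ := Ideal.mem_span_range_iff_exists_fun.1 hg
  rw [map_sum]
  refine Ideal.sum_mem _ fun k _ => ?_
  rw [loweringOp_apply]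
  refine Ideal.sum_mem _ fun i _ => ?_
  suffices h : (X k : MvPolynomial σ K) ^ N k ∣
      C ((N i : K) - 1) * pderiv i (a k * X k ^ N k) -
        X i * pderiv i (pderiv i (a k * X k ^ N k)) from
    Ideal.mem_of_dvd _ h (Ideal.subset_span ⟨k, rfl⟩)
  by_cases hik : i = k
  · subst hik
    obtain ⟨M, hM⟩ : ∃ M, N i = M + 1 := ⟨N i - 1, by have := hN i; lia⟩
    have h1 : X i * pderiv i ((X i : MvPolynomial σ K) ^ M) = (M : MvPolynomial σ K) * X i ^ M := by
      rw [pderiv_pow, pderiv_X_self]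
      cases M with
      | zero => simp
      | succ M => rw [Nat.add_sub_cancel]; ring
    refine ⟨(M : MvPolynomial σ K) * pderiv i (a i) - X i * pderiv i (pderiv i (a i)) -
      2 * ((M : MvPolynomial σ K) + 1) * pderiv i (a i), ?_⟩
    have h2 : pderiv i ((X i : MvPolynomial σ K) ^ (M + 1)) =
        ((M : MvPolynomial σ K) + 1) * X i ^ M := by
      rw [pderiv_pow, pderiv_X_self]
      push_cast
      simp
    have h3 : pderiv i ((M : MvPolynomial σ K) + 1) = 0 := by simp
    rw [hM, pderiv_mul, h2, map_add, pderiv_mul, h2, pderiv_mul, pderiv_mul, h3]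
    simp only [Nat.cast_add, Nat.cast_one, add_sub_cancel_right, map_natCast]
    linear_combination -(a i * ((M : MvPolynomial σ K) + 1)) * h1
  · have h1 : pderiv i ((X k : MvPolynomial σ K) ^ N k) = 0 := by
      rw [pderiv_pow, pderiv_X_of_ne (Ne.symm hik), mul_zero]
    rw [pderiv_mul, h1, mul_zero, add_zero, pderiv_mul, h1, mul_zero, add_zero]
    exact ⟨C ((N i : K) - 1) * pderiv i (a k) - X i * pderiv i (pderiv i (a k)), by ring⟩

/-- The strong Lefschetz property of a monomial complete intersection in characteristic zero:
modulo `(x_k ^ N_k)`, every form of degree `c - i`, with `c = ∑ (N_k - 1)` and `2 i ≤ c`, is a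
multiple of `(∑ x_k) ^ (c - 2 i)`. -/
theorem exists_sub_sum_X_pow_mul_mem [CharZero K] {N : σ → ℕ} (hN : ∀ k, 0 < N k) {i c : ℕ}
    (hc : ∑ k, (N k - 1) = c) (hi : 2 * i ≤ c) {g : MvPolynomial σ K}
    (hg : g.IsHomogeneous (c - i)) :
    ∃ u : MvPolynomial σ K, u.IsHomogeneous i ∧ g - (∑ k, X k) ^ (c - 2 * i) * u ∈
      Ideal.span (Set.range fun k => (X k : MvPolynomial σ K) ^ N k) := by
  set J := Ideal.span (Set.range fun k => (X k : MvPolynomial σ K) ^ N k) with hJ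
  have hcK : ∑ k, ((N k : K) - 1) = c := by
    rw [← hc]
    push_cast
    exact Finset.sum_congr rfl fun k _ => by rw [Nat.cast_sub (hN k), Nat.cast_one]
  let J' : Submodule K (MvPolynomial σ K) := J.restrictScalars K
  let e₀ : Module.End K (MvPolynomial σ K) := LinearMap.mulLeft K (∑ k, X k)
  let h₀ : Module.End K (MvPolynomial σ K) := (2 : K) • eulerOp K σ - (c : K) • LinearMap.id
  have he₀ : J' ≤ J'.comap e₀ := fun a ha => J.mul_mem_left _ ha
  have hf₀ : J' ≤ J'.comap (loweringOp K N) := fun a ha => loweringOp_mem hN ha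
  have ef₀ (a) : e₀ (loweringOp K N a) - loweringOp K N (e₀ a) = h₀ a := by
    simp only [e₀, h₀, LinearMap.mulLeft_apply, loweringOp_sum_X_mul, hcK]
    simp
  have hh₀ : J' ≤ J'.comap h₀ := fun a ha => by
    rw [Submodule.mem_comap, ← ef₀]
    exact sub_mem (he₀ (hf₀ ha)) (hf₀ (he₀ ha))
  let e : Module.End K (MvPolynomial σ K ⧸ J') := J'.mapQ J' e₀ he₀
  let f : Module.End K (MvPolynomial σ K ⧸ J') := J'.mapQ J' (loweringOp K N) hf₀
  let h : Module.End K (MvPolynomial σ K ⧸ J') := J'.mapQ J' h₀ hh₀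
  have e_mk (a) : e (J'.mkQ a) = J'.mkQ (e₀ a) := rfl
  have f_mk (a) : f (J'.mkQ a) = J'.mkQ (loweringOp K N a) := rfl
  have h_mk (a) : h (J'.mkQ a) = J'.mkQ (h₀ a) := rfl
  have e_pow_mk (k : ℕ) (a) : (e ^ k) (J'.mkQ a) = J'.mkQ ((∑ k, X k) ^ k * a) := by
    induction k with
    | zero => simp
    | succ k ih =>
      rw [pow_succ', Module.End.mul_apply, ih, e_mk, pow_succ', mul_assoc]
      rfl
  have f_pow_mk (k : ℕ) (a) : (f ^ k) (J'.mkQ a) = J'.mkQ ((loweringOp K N ^ k) a) := by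
    induction k with
    | zero => simp
    | succ k ih =>
      rw [pow_succ', Module.End.mul_apply, ih, f_mk, pow_succ', Module.End.mul_apply]
  have hef : e * f - f * e = h := by
    refine Submodule.linearMap_qext _ (LinearMap.ext fun a => ?_)
    exact congrArg J'.mkQ (ef₀ a)
  have hhe : h * e - e * h = 2 • e := by
    refine Submodule.linearMap_qext _ (LinearMap.ext fun a => ?_)
    refine congrArg J'.mkQ (?_ : h₀ (e₀ a) - e₀ (h₀ a) = 2 • e₀ a)
    simp only [e₀, h₀, LinearMap.mulLeft_apply, LinearMap.sub_apply, LinearMap.smul_apply,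
      eulerOp_sum_X_mul, LinearMap.id_apply, mul_sub, mul_smul_comm]
    module
  have hhf : h * f - f * h = -(2 • f) := by
    refine Submodule.linearMap_qext _ (LinearMap.ext fun a => ?_)
    refine congrArg J'.mkQ
      (?_ : h₀ (loweringOp K N a) - loweringOp K N (h₀ a) = -(2 • loweringOp K N a))
    simp only [h₀, LinearMap.sub_apply, LinearMap.smul_apply, eulerOp_loweringOp,
      LinearMap.id_apply, map_sub, map_smul]
    module
  have hf (v) : ∃ k, (f ^ k) v = 0 := by
    obtain ⟨a, rfl⟩ := J'.mkQ_surjective v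
    obtain ⟨k, hk⟩ := exists_loweringOp_pow_apply_eq_zero N a
    exact ⟨k, by rw [f_pow_mk, hk, map_zero]⟩
  have he (v) : ∃ k, (e ^ k) v = 0 := by
    obtain ⟨a, rfl⟩ := J'.mkQ_surjective v
    refine ⟨c + 1, ?_⟩
    rw [e_pow_mk, Submodule.mkQ_apply, Submodule.Quotient.mk_eq_zero]
    refine J.mul_mem_right _ (mem_span_range_X_pow_of_lt (d := c + 1) ?_ (by lia))
    simpa using (IsHomogeneous.sum _ _ 1 fun k _ => isHomogeneous_X K k).pow (c + 1)
  have wt {d : ℕ} {a : MvPolynomial σ K} (ha : a.IsHomogeneous d) :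
      h (J'.mkQ a) = ((2 * d - c : ℤ) : K) • J'.mkQ a := by
    rw [h_mk, ← map_smul]
    simp only [h₀, LinearMap.sub_apply, LinearMap.smul_apply, eulerOp_of_isHomogeneous ha,
      LinearMap.id_apply]
    congr 1
    push_cast
    module
  -- `e ^ k ∘ f ^ k` is an injective, hence surjective, operator on the piece of degree `c - i`
  let W : Submodule K (MvPolynomial σ K ⧸ J') := (homogeneousSubmodule σ K (c - i)).map J'.mkQ
  have hWfin : FiniteDimensional K W := by
    have : FiniteDimensional K (homogeneousSubmodule σ K (c - i)) := Module.Finite.iff_fg.2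
      (weightedHomogeneousSubmodule_fg K (1 : σ → ℕ) (by simp) _)
    infer_instance
  let k := c - 2 * i
  have hk : c - i = i + k := by lia
  have hmem {a : MvPolynomial σ K} (ha : a.IsHomogeneous (c - i)) :
      ((∑ k, X k) ^ k * (loweringOp K N ^ k) a).IsHomogeneous (c - i) := by
    have h1 : ((∑ k, X k : MvPolynomial σ K) ^ k).IsHomogeneous k := by
      simpa using (IsHomogeneous.sum _ _ 1 fun k _ => isHomogeneous_X K k).pow k
    rw [hk, add_comm]
    exact h1.mul (isHomogeneous_loweringOp_pow N k (hk ▸ ha))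
  have hW : ∀ w ∈ W, (e ^ k * f ^ k) w ∈ W := by
    rintro _ ⟨a, ha, rfl⟩
    rw [Module.End.mul_apply, f_pow_mk, e_pow_mk]
    exact ⟨_, hmem ha, rfl⟩
  let φ : Module.End K W := (e ^ k * f ^ k).restrict hW
  have hinj : Function.Injective φ := by
    rw [← LinearMap.ker_eq_bot, LinearMap.ker_eq_bot']
    rintro ⟨_, a, ha, rfl⟩ h0
    have h0' : (e ^ k) ((f ^ k) (J'.mkQ a)) = 0 := congrArg Subtype.val h0
    have ha' : a.IsHomogeneous (i + k) := hk ▸ ha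
    have h1 : (f ^ k) (J'.mkQ a) = 0 := by
      refine sl2_eq_zero_of_pow_apply_eq_zero hef hhe hhf hf k (2 * i - c) _ ?_ h0' (by lia)
      rw [f_pow_mk]
      exact wt (isHomogeneous_loweringOp_pow N k ha')
    exact Subtype.ext (sl2_eq_zero_of_pow_apply_eq_zero' hef hhe hhf he k _ _ (wt ha') h1
      (by push_cast; lia))
  obtain ⟨⟨_, a, ha, rfl⟩, h1⟩ := LinearMap.injective_iff_surjective.1 hinj ⟨J'.mkQ g, g, hg, rfl⟩
  have h2 : (e ^ k) ((f ^ k) (J'.mkQ a)) = J'.mkQ g := congrArg Subtype.val h1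
  refine ⟨(loweringOp K N ^ k) a, isHomogeneous_loweringOp_pow N k (hk ▸ ha), ?_⟩
  rw [f_pow_mk, e_pow_mk] at h2
  exact (Submodule.Quotient.eq J').1 h2.symm

end MonomialCompleteIntersection

/-! ### Universal algebras with prescribed elementary symmetric functions -/

section SplittingAlgebra

/-- The elementary symmetric function `e_k (x_1 ^ r, …, x_n ^ r)` of elements of a ring. -/
def powEsymm {T : Type*} [CommRing T] {n : ℕ} (r : ℕ) (x : Fin n → T) (k : ℕ) : T :=
  (Finset.univ.val.map fun j => x j ^ r).esymm k

section powEsymm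

variable {T T' : Type*} [CommRing T] [CommRing T'] {n : ℕ} (r : ℕ)

theorem aeval_esymm_eq_powEsymm (K : Type*) [Field K] [Algebra K T] (x : Fin n → T) (k : ℕ) :
    MvPolynomial.aeval (fun j => x j ^ r) (MvPolynomial.esymm (Fin n) K k) = powEsymm r x k :=
  MvPolynomial.aeval_esymm_eq_multiset_esymm _ _ _ _

@[simp]
theorem powEsymm_zero (x : Fin n → T) : powEsymm r x 0 = 1 := by
  simp [powEsymm, Multiset.esymm]

theorem powEsymm_of_lt (x : Fin n → T) {k : ℕ} (hk : n < k) : powEsymm r x k = 0 := by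
  rw [powEsymm, Multiset.esymm, Multiset.powersetCard_eq_empty _ (by simpa using hk)]
  simp

theorem multiset_esymm_cons_succ (a : T) (s : Multiset T) (k : ℕ) :
    (a ::ₘ s).esymm (k + 1) = s.esymm (k + 1) + a * s.esymm k := by
  simp [Multiset.esymm, Multiset.powersetCard_cons, Multiset.map_map, Multiset.sum_map_mul_left]

theorem powEsymm_succ (x : Fin (n + 1) → T) (k : ℕ) :
    powEsymm r x (k + 1) = powEsymm r (fun j => x j.succ) (k + 1) +
      x 0 ^ r * powEsymm r (fun j => x j.succ) k := by
  have h : (Finset.univ.val.map fun j => x j ^ r) =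
      x 0 ^ r ::ₘ Finset.univ.val.map fun j : Fin n => x j.succ ^ r := by
    rw [Fin.univ_val_map, Fin.univ_val_map, List.ofFn_succ]
    rfl
  rw [powEsymm, h, multiset_esymm_cons_succ]
  rfl

theorem map_powEsymm {F : Type*} [FunLike F T T'] [RingHomClass F T T'] (φ : F)
    (x : Fin n → T) (k : ℕ) : φ (powEsymm r x k) = powEsymm r (fun j => φ (x j)) k := by
  have h : (Finset.univ.val.map fun j => φ (x j) ^ r) =
      (Finset.univ.val.map fun j => x j ^ r).map φ := by
    simp only [Multiset.map_map, Function.comp_def, map_pow]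
  rw [powEsymm, powEsymm, h, Multiset.esymm, Multiset.esymm, Multiset.powersetCard_map φ,
    map_multiset_sum, Multiset.map_map, Multiset.map_map]
  simp only [Function.comp_def, map_multiset_prod]

end powEsymm

open Polynomial in
/-- The polynomial `(-1)^k (t ^ (r k) - c_1 t ^ (r (k - 1)) + ⋯ ± c_k)` in `t`. If `c_j` are the
elementary symmetric functions of `x_0 ^ r, x_1 ^ r, …`, its value at `x_0` is the `k`-th
elementary symmetric function of the remaining `x_1 ^ r, x_2 ^ r, …`. -/
noncomputable def residualEsymm {S : Type*} [CommRing S] (r : ℕ) (c : ℕ → S) : ℕ → S[X]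
  | 0 => 1
  | k + 1 => C (c (k + 1)) - X ^ r * residualEsymm r c k

open Polynomial in
theorem monic_residualEsymm {S : Type*} [CommRing S] [Nontrivial S] {r : ℕ} (hr : 0 < r)
    (c : ℕ → S) (k : ℕ) : ((-1) ^ k * residualEsymm r c k).Monic ∧
      ((-1) ^ k * residualEsymm r c k).natDegree = r * k := by
  induction k with
  | zero => simp [residualEsymm]
  | succ k ih =>
    have h1 : (-1) ^ (k + 1) * residualEsymm r c (k + 1) =
        X ^ r * ((-1) ^ k * residualEsymm r c k) + C ((-1) ^ (k + 1) * c (k + 1)) := by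
      rw [residualEsymm, C_mul, C_pow, C_neg, C_1]
      ring
    have hm : (X ^ r * ((-1) ^ k * residualEsymm r c k)).Monic := (monic_X_pow r).mul ih.1
    have hd : (X ^ r * ((-1) ^ k * residualEsymm r c k)).natDegree = r * (k + 1) := by
      rw [(monic_X_pow r).natDegree_mul ih.1, ih.2, natDegree_X_pow]
      ring
    have hpos : 0 < r * (k + 1) := by positivity
    rw [h1, natDegree_add_C]
    refine ⟨hm.add_of_left (degree_C_le.trans_lt ?_), hd⟩
    exact natDegree_pos_iff_degree_pos.1 (hd ▸ hpos)

open MvPolynomial in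
/-- The universal algebra `T = S[x] / (e_k (x ^ r) = c_k)` in which the `r`-th powers of
`x_1, …, x_n` have prescribed elementary symmetric functions is free of rank `r ^ n * n!` over `S`:
it is obtained by adjoining `x_1`, a root of a monic polynomial of degree `r n`, and then solving
the same problem for the remaining variables. -/
theorem nonempty_basis_of_ker_aeval_eq {r : ℕ} (hr : 0 < r) (n : ℕ) {S T : Type*} [CommRing S]
    [Nontrivial S] [CommRing T] [Algebra S T] (c : ℕ → S) (x : Fin n → T)
    (hsurj : Function.Surjective (aeval x : MvPolynomial (Fin n) S →ₐ[S] T))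
    (hker : RingHom.ker (aeval x : MvPolynomial (Fin n) S →ₐ[S] T) =
      Ideal.span (Set.range fun i : Fin n =>
        powEsymm r (X : Fin n → MvPolynomial (Fin n) S) (i + 1) - C (c (i + 1)))) :
    Nonempty (Module.Basis (Fin (r ^ n * n.factorial)) S T) := by
  induction n generalizing S with
  | zero =>
    have hbij : Function.Bijective (algebraMap S T) := by
      have h1 : ∀ s, aeval x (C s : MvPolynomial (Fin 0) S) = algebraMap S T s := fun s => by simp
      constructor
      · rw [injective_iff_map_eq_zero]
        intro s hs
        have : (C s : MvPolynomial (Fin 0) S) ∈ RingHom.ker (aeval x : _ →ₐ[S] T) := by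
          rw [RingHom.mem_ker, h1, hs]
        rw [hker, Set.range_eq_empty, Ideal.span_empty, Ideal.mem_bot] at this
        exact C_eq_zero.1 this
      · intro t
        obtain ⟨p, rfl⟩ := hsurj t
        obtain ⟨s, rfl⟩ := C_surjective (Fin 0) p
        exact ⟨s, (h1 s).symm⟩
    let e : S ≃ₗ[S] T := LinearEquiv.ofBijective (Algebra.linearMap S T) hbij
    exact ⟨((Module.Basis.singleton (Fin 1) S).map e).reindex (finCongr (by simp))⟩
  | succ n ih =>
    let Q := residualEsymm r c
    let q : Polynomial S := (-1) ^ (n + 1) * Q (n + 1)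
    obtain ⟨hq, hqd⟩ : q.Monic ∧ q.natDegree = r * (n + 1) := monic_residualEsymm hr c (n + 1)
    let x' : Fin n → T := fun j => x j.succ
    have hx (k : ℕ) (hk : k < n + 1) : powEsymm r x (k + 1) = algebraMap S T (c (k + 1)) := by
      have : powEsymm r (X : Fin (n + 1) → MvPolynomial (Fin (n + 1)) S) (k + 1) - C (c (k + 1)) ∈
          RingHom.ker (aeval x : _ →ₐ[S] T) := by
        rw [hker]
        exact Ideal.subset_span ⟨⟨k, hk⟩, rfl⟩
      rw [RingHom.mem_ker, map_sub, map_powEsymm, sub_eq_zero] at this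
      simpa using this
    have hQ (k : ℕ) (hk : k ≤ n + 1) : Polynomial.aeval (x 0) (Q k) = powEsymm r x' k := by
      induction k with
      | zero => simp [Q, residualEsymm]
      | succ k ihk =>
        have h1 := powEsymm_succ r x k
        rw [hx k (by lia)] at h1
        simp only [Q, residualEsymm, map_sub, map_mul, map_pow, Polynomial.aeval_X,
          Polynomial.aeval_C] at ihk ⊢
        rw [ihk (by lia), h1, add_sub_cancel_right]
    have hroot : Polynomial.eval₂ (algebraMap S T) (x 0) q = 0 := by
      have h1 := hQ (n + 1) le_rfl
      rw [powEsymm_of_lt r x' (Nat.lt_succ_self n)] at h1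
      change Polynomial.aeval (x 0) q = 0
      rw [map_mul, h1, mul_zero]
    let S' := AdjoinRoot q
    let b := (AdjoinRoot.powerBasis' hq).basis.reindex
      (finCongr ((AdjoinRoot.powerBasis'_dim hq).trans hqd))
    have : Nontrivial S' := by
      have h1 : 0 < r * (n + 1) := by positivity
      exact ⟨_, _, b.ne_zero ⟨0, h1⟩⟩
    -- `T` is an algebra over `S' = S[t] / (q)` with `t` acting as `x_0`
    let _ : Algebra S' T := (AdjoinRoot.lift (algebraMap S T) (x 0) hroot).toAlgebra
    have halg (p : Polynomial S) :
        algebraMap S' T (AdjoinRoot.mk q p) = Polynomial.aeval (x 0) p :=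
      AdjoinRoot.lift_mk hroot p
    have : IsScalarTower S S' T := IsScalarTower.of_algebraMap_eq fun s => by
      rw [AdjoinRoot.algebraMap_eq, ← AdjoinRoot.mk_C, halg, Polynomial.aeval_C]
    let c' : ℕ → S' := fun k => AdjoinRoot.mk q (Q k)
    -- `ψ` presents `S'[x_1, …, x_n]` as a quotient of `S[x_0, …, x_n]`, to compare the two kernels
    let ψ : MvPolynomial (Fin (n + 1)) S →ₐ[S] MvPolynomial (Fin n) S' :=
      aeval (Fin.cons (C (AdjoinRoot.root q)) X)
    have hψ0 : ψ (X 0) = C (AdjoinRoot.root q) := by simp [ψ]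
    have hψsucc (j : Fin n) : ψ (X j.succ) = X j := by simp [ψ]
    have hψC (s : S) : ψ (C s) = C (algebraMap S S' s) := by
      rw [← MvPolynomial.algebraMap_eq, AlgHom.commutes]
      rfl
    have hcomp (p) : (aeval x' : _ →ₐ[S'] T) (ψ p) = aeval x p := by
      have : ((aeval x' : MvPolynomial (Fin n) S' →ₐ[S'] T).restrictScalars S).comp ψ =
          aeval x := by
        refine MvPolynomial.algHom_ext fun j => ?_
        refine Fin.cases ?_ (fun j => ?_) j
        · simp only [AlgHom.comp_apply, AlgHom.restrictScalars_apply, hψ0, aeval_C, aeval_X]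
          rw [← AdjoinRoot.mk_X, halg, Polynomial.aeval_X]
        · simp only [AlgHom.comp_apply, AlgHom.restrictScalars_apply, hψsucc, aeval_X, x']
      exact DFunLike.congr_fun this p
    have hψsurj : Function.Surjective ψ := by
      intro p
      induction p using MvPolynomial.induction_on with
      | C s =>
        obtain ⟨p, rfl⟩ := AdjoinRoot.mk_surjective s
        refine ⟨Polynomial.aeval (X 0) p, ?_⟩
        rw [← Polynomial.aeval_algHom_apply, hψ0]
        induction p using Polynomial.induction_on' with
        | add p q hp hq => rw [map_add, hp, hq, map_add, map_add]
        | monomial k s =>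
          rw [Polynomial.aeval_monomial, ← Polynomial.C_mul_X_pow_eq_monomial, map_mul, map_pow,
            AdjoinRoot.mk_C, AdjoinRoot.mk_X, map_mul, map_pow]
          rfl
      | add p p' hp hp' =>
        obtain ⟨a, rfl⟩ := hp
        obtain ⟨a', rfl⟩ := hp'
        exact ⟨a + a', map_add _ _ _⟩
      | mul_X p j hp =>
        obtain ⟨a, rfl⟩ := hp
        exact ⟨a * X j.succ, by rw [map_mul, hψsucc]⟩
    set I' := Ideal.span (Set.range fun i : Fin n =>
        powEsymm r (X : Fin n → MvPolynomial (Fin n) S') (i + 1) - C (c' (i + 1))) with hI'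
    have hmem (k : ℕ) (hk : k ≤ n + 1) :
        powEsymm r (X : Fin n → MvPolynomial (Fin n) S') k - C (c' k) ∈ I' := by
      rcases k with _ | k
      · simp [c', Q, residualEsymm]
      · rcases Nat.lt_or_ge k n with hkn | hkn
        · exact Ideal.subset_span ⟨⟨k, hkn⟩, rfl⟩
        · obtain rfl : k = n := by lia
          have h1 : c' (k + 1) = 0 := by
            refine AdjoinRoot.mk_eq_zero.2 ⟨(-1) ^ (k + 1), ?_⟩
            simp only [q]
            rw [mul_right_comm, ← mul_pow]
            simp
          rw [powEsymm_of_lt r _ (Nat.lt_succ_self k), h1]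
          simp
    obtain ⟨b'⟩ := ih c' x' (fun t => by
        obtain ⟨p, rfl⟩ := hsurj t
        exact ⟨ψ p, hcomp p⟩) (by
      apply le_antisymm
      · intro p hp
        obtain ⟨p, rfl⟩ := hψsurj p
        rw [RingHom.mem_ker, hcomp, ← RingHom.mem_ker, hker] at hp
        have h1 : Ideal.span (Set.range fun i : Fin (n + 1) =>
            powEsymm r (X : Fin (n + 1) → MvPolynomial (Fin (n + 1)) S) (i + 1) -
              C (c (i + 1))) ≤ I'.comap ψ := by
          rw [Ideal.span_le]
          rintro _ ⟨⟨k, hk⟩, rfl⟩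
          rw [SetLike.mem_coe, Ideal.mem_comap, map_sub, map_powEsymm, powEsymm_succ, hψ0, hψC]
          simp only [hψsucc]
          have h2 : algebraMap S S' (c (k + 1)) =
              c' (k + 1) + AdjoinRoot.root q ^ r * c' k := by
            simp only [c', Q, residualEsymm, map_sub, map_mul, map_pow, AdjoinRoot.mk_X,
              AdjoinRoot.mk_C]
            exact (sub_add_cancel _ _).symm
          rw [h2]
          have h3 := I'.add_mem (hmem (k + 1) (by lia))
            (I'.mul_mem_left (C (AdjoinRoot.root q) ^ r) (hmem k (by lia)))
          convert h3 using 1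
          simp only [map_add, map_mul, map_pow]
          ring
        exact h1 hp
      · rw [Ideal.span_le]
        rintro _ ⟨i, rfl⟩
        rw [SetLike.mem_coe, RingHom.mem_ker, map_sub, map_powEsymm, aeval_C, halg,
          hQ _ (by lia)]
        simp [x'])
    refine ⟨(b.smulTower b').reindex (finProdFinEquiv.trans (finCongr ?_))⟩
    rw [Nat.factorial_succ]
    ring

end SplittingAlgebra

/-! ### Regularity of the sequence and dimension of the quotient -/

section RegularSequence

open MvPolynomial

theorem powEsymm_self {T : Type*} [CommRing T] {n : ℕ} (r : ℕ) (x : Fin n → T) :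
    powEsymm r x n = ∏ j, x j ^ r := by
  induction n with
  | zero => simp
  | succ n ih =>
    rw [powEsymm_succ, powEsymm_of_lt _ _ (Nat.lt_succ_self n), ih, zero_add,
      Fin.prod_univ_succ]

/-- The exponents `1, …, 1, m` on a sequence of length `n`. -/
def lastExponent (n m : ℕ) (i : Fin n) : ℕ := if (i : ℕ) + 1 < n then 1 else m

theorem lastExponent_pos {n m : ℕ} (hm : 0 < m) (i : Fin n) : 0 < lastExponent n m i := by
  unfold lastExponent
  split_ifs <;> lia

theorem prod_lastExponent {n : ℕ} (hn : 0 < n) (m : ℕ) : ∏ i, lastExponent n m i = m := by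
  obtain ⟨n, rfl⟩ := Nat.exists_eq_add_one.2 hn
  rw [Fin.prod_univ_castSucc]
  simp [lastExponent]

theorem esymmOfPowers_eq_pow (K : Type*) [Field K] (n r m : ℕ) (i : Fin n) :
    esymmOfPowers K n r (r * m) i =
      powEsymm r (X : Fin n → MvPolynomial (Fin n) K) (i + 1) ^ lastExponent n m i := by
  unfold esymmOfPowers lastExponent
  split_ifs with h
  · rw [aeval_esymm_eq_powEsymm, pow_one]
  · have h1 : (i : ℕ) + 1 = n := by lia
    rw [aeval_esymm_eq_powEsymm, h1, powEsymm_self, powEsymm_self, ← Finset.prod_pow]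
    simp only [pow_mul]

/-- A homomorphism `σ` inducing an inverse identifies `T` with the quotient `S[x] / I`. -/
theorem ker_eval₂Hom_eq_of_section {S T : Type*} [CommRing S] [CommRing T] {n : ℕ} (φ : S →+* T)
    (x : Fin n → T) (I : Ideal (MvPolynomial (Fin n) S))
    (hI : I ≤ RingHom.ker (eval₂Hom φ x)) (σ : T →+* MvPolynomial (Fin n) S ⧸ I)
    (hσx : ∀ j, σ (x j) = Ideal.Quotient.mk I (X j))
    (hσφ : ∀ s, σ (φ s) = Ideal.Quotient.mk I (C s)) :
    RingHom.ker (eval₂Hom φ x) = I := by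
  refine le_antisymm (fun p hp => ?_) hI
  have h1 : σ.comp (eval₂Hom φ x) = Ideal.Quotient.mk I :=
    MvPolynomial.ringHom_ext (fun s => by simp [hσφ]) (fun j => by simp [hσx])
  rw [← Ideal.Quotient.eq_zero_iff_mem, ← h1, RingHom.comp_apply, RingHom.mem_ker.1 hp, map_zero]

theorem powEsymm_mk_X {S : Type*} [CommRing S] {n : ℕ} (r : ℕ) (c : ℕ → S)
    {I : Ideal (MvPolynomial (Fin n) S)} (hI : I = Ideal.span (Set.range fun i : Fin n =>
      powEsymm r (X : Fin n → MvPolynomial (Fin n) S) (i + 1) - C (c (i + 1)))) (i : Fin n) :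
    powEsymm r (fun j : Fin n => Ideal.Quotient.mk I (X j)) (i + 1) =
      Ideal.Quotient.mk I (C (c (i + 1))) := by
  rw [← map_powEsymm r (Ideal.Quotient.mk I), ← sub_eq_zero, ← map_sub,
    Ideal.Quotient.eq_zero_iff_mem, hI]
  exact Ideal.subset_span ⟨i, rfl⟩

theorem flat_of_ker_eval₂Hom_eq {r : ℕ} (hr : 0 < r) {n : ℕ} {S T : Type*} [CommRing S]
    [Nontrivial S] [CommRing T] (φ : S →+* T) (c : ℕ → S) (x : Fin n → T)
    (hsurj : Function.Surjective (eval₂Hom φ x))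
    (hker : RingHom.ker (eval₂Hom φ x) = Ideal.span (Set.range fun i : Fin n =>
      powEsymm r (X : Fin n → MvPolynomial (Fin n) S) (i + 1) - C (c (i + 1)))) :
    φ.Flat := by
  let _ : Algebra S T := φ.toAlgebra
  obtain ⟨b⟩ := nonempty_basis_of_ker_aeval_eq hr n c x hsurj hker
  have := Module.Free.of_basis b
  exact Module.Flat.of_free

theorem isWeaklyRegular_map_of_flat {S T : Type*} [CommRing S] [CommRing T] {φ : S →+* T}
    (hφ : φ.Flat) {l : List S} (hl : RingTheory.Sequence.IsWeaklyRegular S l) :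
    RingTheory.Sequence.IsWeaklyRegular T (l.map φ) := by
  let _ : Algebra S T := φ.toAlgebra
  have : Module.Flat S T := hφ
  exact hl.of_flat

variable (K : Type*) [Field K]

/-- A polynomial ring is flat over the subring generated by the elementary symmetric functions of
the `r`-th powers of the variables. -/
theorem flat_aeval_powEsymm {r : ℕ} (hr : 0 < r) (n : ℕ) :
    (aeval fun i : Fin n => powEsymm r (X : Fin n → MvPolynomial (Fin n) K) (i + 1) :
      MvPolynomial (Fin n) K →ₐ[K] MvPolynomial (Fin n) K).toRingHom.Flat := by
  set φ : MvPolynomial (Fin n) K →ₐ[K] MvPolynomial (Fin n) K :=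
    aeval fun i : Fin n => powEsymm r (X : Fin n → MvPolynomial (Fin n) K) (i + 1)
  let c : ℕ → MvPolynomial (Fin n) K := fun k => if h : k - 1 < n then X ⟨k - 1, h⟩ else 0
  have hc (i : Fin n) : c (i + 1) = X i := by simp [c]
  refine flat_of_ker_eval₂Hom_eq hr φ.toRingHom c X ?_ ?_
  · intro p
    induction p using MvPolynomial.induction_on with
    | C a => exact ⟨C (C a), by simp [φ]⟩
    | add p q hp hq =>
      obtain ⟨a, rfl⟩ := hp
      obtain ⟨b, rfl⟩ := hq
      exact ⟨a + b, map_add _ _ _⟩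
    | mul_X p j hp =>
      obtain ⟨a, rfl⟩ := hp
      exact ⟨a * X j, by rw [map_mul, eval₂Hom_X']⟩
  · set I := Ideal.span (Set.range fun i : Fin n =>
      powEsymm r (X : Fin n → MvPolynomial (Fin n) (MvPolynomial (Fin n) K)) (i + 1) -
        C (c (i + 1))) with hI
    let σ : MvPolynomial (Fin n) K →+*
        MvPolynomial (Fin n) (MvPolynomial (Fin n) K) ⧸ I :=
      eval₂Hom ((Ideal.Quotient.mk I).comp (C.comp C)) fun j => Ideal.Quotient.mk I (X j)
    refine ker_eval₂Hom_eq_of_section _ _ I ?_ σ (fun j => by simp [σ]) (fun s => ?_)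
    · rw [hI, Ideal.span_le]
      rintro _ ⟨i, rfl⟩
      rw [SetLike.mem_coe, RingHom.mem_ker, map_sub, map_powEsymm, eval₂Hom_C, hc]
      simp [φ]
    · have h1 : σ.comp φ.toRingHom = (Ideal.Quotient.mk I).comp C := by
        refine MvPolynomial.ringHom_ext (fun a => by simp [σ, φ]) (fun i => ?_)
        have h2 := powEsymm_mk_X r c hI i
        rw [hc] at h2
        rw [RingHom.comp_apply, RingHom.comp_apply, ← h2]
        simp [φ, map_powEsymm, σ]
      exact RingHom.congr_fun h1 s

theorem isWeaklyRegular_X_pow {n : ℕ} (M : Fin n → ℕ) :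
    RingTheory.Sequence.IsWeaklyRegular (MvPolynomial (Fin n) K)
      (List.ofFn fun i => (X i : MvPolynomial (Fin n) K) ^ M i) := by
  refine ⟨fun i hi => ?_⟩
  have hi' : i < n := by simpa using hi
  have hspan : (Ideal.ofList ((List.ofFn fun i => (X i : MvPolynomial (Fin n) K) ^ M i).take i) •
      ⊤ : Ideal (MvPolynomial (Fin n) K)) =
      Ideal.span ((fun k => (X k : MvPolynomial (Fin n) K) ^ M k) '' {k | (k : ℕ) < i}) := by
    rw [smul_eq_mul, Ideal.mul_top, Ideal.ofList]
    congr 1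
    ext p
    simp only [List.mem_take_iff_getElem, List.getElem_ofFn, List.length_ofFn, Set.mem_image,
      Set.mem_ofPred_eq]
    constructor
    · rintro ⟨j, hj, rfl⟩
      exact ⟨⟨j, by lia⟩, by simp; lia, rfl⟩
    · rintro ⟨k, hk, rfl⟩
      exact ⟨k, by have := k.2; lia, rfl⟩
  rw [isSMulRegular_quotient_iff_mem_of_smul_mem, hspan, List.getElem_ofFn]
  intro g hg
  rw [smul_eq_mul, X_pow_eq_monomial, mem_span_X_pow_image_iff] at hg
  rw [mem_span_X_pow_image_iff]
  intro b hb
  obtain ⟨k, hk, hkb⟩ := hg (Finsupp.single ⟨i, hi'⟩ (M ⟨i, hi'⟩) + b) (by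
    rw [mem_support_iff, coeff_monomial_mul, one_mul]
    exact mem_support_iff.1 hb)
  refine ⟨k, hk, ?_⟩
  have hne : (⟨i, hi'⟩ : Fin n) ≠ k := by
    rintro rfl
    exact lt_irrefl i hk
  simpa [Finsupp.single_eq_of_ne' hne] using hkb

theorem isRegular_esymmOfPowers {n r m : ℕ} (hr : 0 < r) (hm : 0 < m) :
    RingTheory.Sequence.IsRegular (MvPolynomial (Fin n) K)
      (List.ofFn (esymmOfPowers K n r (r * m))) := by
  refine ⟨?_, ?_⟩
  · have h := isWeaklyRegular_map_of_flat (flat_aeval_powEsymm K hr n)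
      (isWeaklyRegular_X_pow K (lastExponent n m))
    have h1 : List.ofFn (esymmOfPowers K n r (r * m)) =
        (List.ofFn fun i => (X i : MvPolynomial (Fin n) K) ^ lastExponent n m i).map
          (aeval fun i : Fin n => powEsymm r (X : Fin n → MvPolynomial (Fin n) K) (i + 1) :
            MvPolynomial (Fin n) K →ₐ[K] MvPolynomial (Fin n) K).toRingHom := by
      rw [List.map_ofFn]
      congr 1
      funext i
      rw [esymmOfPowers_eq_pow]
      simp
    rw [h1]
    exact h
  · -- all the polynomials vanish at the origin
    intro h
    rw [smul_eq_mul, Ideal.mul_top, eq_comm, Ideal.eq_top_iff_one] at h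
    have hle : Ideal.ofList (List.ofFn (esymmOfPowers K n r (r * m))) ≤
        RingHom.ker (constantCoeff : MvPolynomial (Fin n) K →+* K) := by
      rw [Ideal.ofList, Ideal.span_le]
      intro p hp
      obtain ⟨i, rfl⟩ := (List.mem_ofFn' _ _).1 hp
      rw [SetLike.mem_coe, RingHom.mem_ker, esymmOfPowers_eq_pow, map_pow, map_powEsymm]
      have h0 : powEsymm r (fun j : Fin n => constantCoeff (X j : MvPolynomial (Fin n) K))
          (i + 1) = 0 := by
        obtain ⟨r, rfl⟩ := Nat.exists_eq_add_one.2 hr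
        rw [powEsymm, Multiset.esymm]
        refine Multiset.sum_eq_zero fun a ha => ?_
        obtain ⟨s, hs, rfl⟩ := Multiset.mem_map.1 ha
        obtain ⟨hs1, hs2⟩ := Multiset.mem_powersetCard.1 hs
        obtain ⟨a, ha⟩ := Multiset.card_pos_iff_exists_mem.1 (by rw [hs2]; lia : 0 < s.card)
        refine Multiset.prod_eq_zero ?_
        obtain ⟨j, -, hj⟩ := Multiset.mem_map.1 (Multiset.mem_of_le hs1 ha)
        rw [constantCoeff_X, zero_pow (Nat.succ_ne_zero r)] at hj
        rwa [hj]
      rw [h0, zero_pow (lastExponent_pos hm i).ne']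
    exact one_ne_zero ((map_one constantCoeff).symm.trans (RingHom.mem_ker.1 (hle h)) : (1 : K) = 0)

/-- The quotient by the `f_i` has a basis of `m r ^ n n!` elements: it is free of rank `r ^ n * n!`
over `K[t] / (t ^ m)`, where `t` acts as `e_n (x ^ r)`. -/
theorem nonempty_basis_quotient_esymmOfPowers {n r m : ℕ} (hn : 0 < n) (hr : 0 < r) (hm : 0 < m) :
    Nonempty (Module.Basis (Fin (m * (r ^ n * n.factorial))) K
      (MvPolynomial (Fin n) K ⧸ Ideal.span (Set.range (esymmOfPowers K n r (r * m))))) := by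
  set I := Ideal.span (Set.range (esymmOfPowers K n r (r * m))) with hI
  let q : Polynomial K := Polynomial.X ^ m
  have hq : q.Monic := Polynomial.monic_X_pow m
  let S := AdjoinRoot q
  have : Nontrivial S := AdjoinRoot.nontrivial q (by simp [q, hm.ne'])
  let x : Fin n → MvPolynomial (Fin n) K ⧸ I := fun j => Ideal.Quotient.mk I (X j)
  have hrel (i : Fin n) : powEsymm r x (i + 1) ^ lastExponent n m i = 0 := by
    rw [← map_powEsymm r (Ideal.Quotient.mk I), ← map_pow, ← esymmOfPowers_eq_pow,
      Ideal.Quotient.eq_zero_iff_mem]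
    exact Ideal.subset_span ⟨i, rfl⟩
  have hroot : Polynomial.eval₂ (algebraMap K _) (powEsymm r x n) q = 0 := by
    have h1 := hrel ⟨n - 1, by lia⟩
    have h2 : n - 1 + 1 = n := by lia
    simp only [lastExponent, h2, lt_irrefl, if_false] at h1
    simpa [q] using h1
  -- `t` acts as `e_n (x ^ r)`, whose `m`-th power is `f_n = 0`
  let φ : S →+* MvPolynomial (Fin n) K ⧸ I := AdjoinRoot.lift (algebraMap K _) _ hroot
  let _ : Algebra S (MvPolynomial (Fin n) K ⧸ I) := φ.toAlgebra
  have : IsScalarTower K S (MvPolynomial (Fin n) K ⧸ I) :=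
    IsScalarTower.of_algebraMap_eq fun s => (AdjoinRoot.lift_of hroot).symm
  have hφroot : φ (AdjoinRoot.mk q Polynomial.X) = powEsymm r x n := AdjoinRoot.lift_root hroot
  have hφC (a : K) : φ (AdjoinRoot.mk q (Polynomial.C a)) = Ideal.Quotient.mk I (C a) :=
    AdjoinRoot.lift_of hroot
  let c : ℕ → S := fun k => if k = n then AdjoinRoot.root q else 0
  have hφc (i : Fin n) : φ (c (i + 1)) = powEsymm r x (i + 1) := by
    by_cases h : (i : ℕ) + 1 = n
    · simp only [c, h, if_true]
      exact hφroot
    · have h1 := hrel i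
      rw [lastExponent, if_pos (by lia), pow_one] at h1
      simp [c, h, h1]
  have hcpow (i : Fin n) : c (i + 1) ^ lastExponent n m i = 0 := by
    by_cases h : (i : ℕ) + 1 = n
    · have h1 : AdjoinRoot.root q ^ m = 0 := by
        rw [← AdjoinRoot.mk_X, ← map_pow]
        exact AdjoinRoot.mk_self
      simp [c, h, lastExponent, h1]
    · simp [c, h, (lastExponent_pos hm i).ne']
  obtain ⟨b⟩ := nonempty_basis_of_ker_aeval_eq hr n c x (fun t => by
    obtain ⟨p, rfl⟩ := Ideal.Quotient.mk_surjective t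
    induction p using MvPolynomial.induction_on with
    | C a => exact ⟨C (algebraMap K S a), by
        rw [aeval_C, ← IsScalarTower.algebraMap_apply]; rfl⟩
    | add p q hp hq =>
      obtain ⟨a, ha⟩ := hp
      obtain ⟨b, hb⟩ := hq
      exact ⟨a + b, by rw [map_add, ha, hb, map_add]⟩
    | mul_X p j hp =>
      obtain ⟨a, ha⟩ := hp
      exact ⟨a * X j, by rw [map_mul, aeval_X, ha, map_mul]⟩) (by
    set I' := Ideal.span (Set.range fun i : Fin n =>
      powEsymm r (X : Fin n → MvPolynomial (Fin n) S) (i + 1) - C (c (i + 1))) with hI'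
    have hmk := powEsymm_mk_X r c hI'
    -- the inverse isomorphism, induced by `x_j ↦ x_j`
    let σ₀ : MvPolynomial (Fin n) K →+* MvPolynomial (Fin n) S ⧸ I' :=
      eval₂Hom ((Ideal.Quotient.mk I').comp (C.comp (algebraMap K S)))
        fun j => Ideal.Quotient.mk I' (X j)
    have hσ₀ : ∀ p ∈ I, σ₀ p = 0 := by
      have : I ≤ RingHom.ker σ₀ := by
        rw [hI, Ideal.span_le]
        rintro _ ⟨i, rfl⟩
        rw [SetLike.mem_coe, RingHom.mem_ker, esymmOfPowers_eq_pow, map_pow, map_powEsymm]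
        simp only [σ₀, eval₂Hom_X']
        rw [hmk, ← map_pow, ← map_pow, hcpow, map_zero, map_zero]
      exact fun p hp => this hp
    refine ker_eval₂Hom_eq_of_section φ x I' ?_ (Ideal.Quotient.lift I σ₀ hσ₀)
      (fun j => by simp [x, σ₀]) (fun s => ?_)
    · rw [hI', Ideal.span_le]
      rintro _ ⟨i, rfl⟩
      rw [SetLike.mem_coe, RingHom.mem_ker, map_sub, map_powEsymm, eval₂Hom_C, hφc]
      simp
    · obtain ⟨p, rfl⟩ := AdjoinRoot.mk_surjective s
      have h1 : ((Ideal.Quotient.lift I σ₀ hσ₀).comp φ).comp (AdjoinRoot.mk q) =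
          ((Ideal.Quotient.mk I').comp C).comp (AdjoinRoot.mk q) := by
        refine Polynomial.ringHom_ext (fun a => ?_) ?_
        · rw [RingHom.comp_apply, RingHom.comp_apply, hφC, Ideal.Quotient.lift_mk]
          simp only [σ₀, eval₂Hom_C]
          rfl
        · have h2 := hmk ⟨n - 1, by lia⟩
          have h3 : n - 1 + 1 = n := by lia
          simp only [h3, c, if_true] at h2
          rw [RingHom.comp_apply, RingHom.comp_apply, hφroot, RingHom.comp_apply,
            RingHom.comp_apply, AdjoinRoot.mk_X, ← h2,
            map_powEsymm r (Ideal.Quotient.lift I σ₀ hσ₀)]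
          simp [x, σ₀]
      exact RingHom.congr_fun h1 p)
  let b₀ := (AdjoinRoot.powerBasis' hq).basis.reindex
    (finCongr ((AdjoinRoot.powerBasis'_dim hq).trans (Polynomial.natDegree_X_pow m)))
  exact ⟨(b₀.smulTower b).reindex finProdFinEquiv⟩

end RegularSequence

/-! ### Leading forms in the ideal -/

section LeadingForms

theorem coeff_prod_one_sub_C_mul_X {T : Type*} [CommRing T] (s : Multiset T) (k : ℕ) :
    PowerSeries.coeff k (s.map fun a => 1 - PowerSeries.C a * PowerSeries.X).prod =
      (-1) ^ k * s.esymm k := by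
  induction s using Multiset.induction_on generalizing k with
  | empty =>
    cases k with
    | zero => simp [Multiset.esymm]
    | succ k =>
      rw [Multiset.esymm, Multiset.powersetCard_eq_empty _ (by simp)]
      simp [PowerSeries.coeff_one]
  | cons a s ih =>
    rw [Multiset.map_cons, Multiset.prod_cons, sub_mul, one_mul, map_sub, mul_assoc,
      PowerSeries.coeff_C_mul, ih]
    cases k with
    | zero => simp [Multiset.esymm]
    | succ k =>
      rw [PowerSeries.coeff_succ_X_mul, ih, multiset_esymm_cons_succ]
      ring

theorem one_sub_C_mul_X_mul_mk_pow {T : Type*} [CommRing T] (a : T) :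
    (1 - PowerSeries.C a * PowerSeries.X) * PowerSeries.mk (fun j => a ^ j) = 1 := by
  ext k
  rw [sub_mul, one_mul, map_sub, mul_assoc, PowerSeries.coeff_C_mul]
  cases k with
  | zero => simp
  | succ k => simp [PowerSeries.coeff_succ_X_mul, PowerSeries.coeff_one, pow_succ']

/-- If the elementary symmetric functions of `x ^ r` vanish in degrees `1, …, k`, then the
complete homogeneous symmetric function of degree `k + 1` in `x_k ^ r, x_{k + 1} ^ r, …` equals
`± e_{k + 1} (x ^ r)` (indices starting at zero): compare coefficients in
`∏_i (1 - x_i ^ r t) * ∏_{i ≥ k} (1 - x_i ^ r t)⁻¹ = ∏_{i < k} (1 - x_i ^ r t)`. -/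
theorem sum_finsuppAntidiag_prod_pow_eq {T : Type*} [CommRing T] {n : ℕ} (r : ℕ) (x : Fin n → T)
    (k : Fin n) (hx : ∀ i, 0 < i → i ≤ (k : ℕ) → powEsymm r x i = 0) :
    ∑ l ∈ (Finset.Ici k).finsuppAntidiag ((k : ℕ) + 1), ∏ i ∈ Finset.Ici k, (x i ^ r) ^ l i =
      (-1) ^ (k : ℕ) * powEsymm r x (k + 1) := by
  classical
  let E : Finset (Fin n) → PowerSeries T := fun s =>
    ∏ i ∈ s, (1 - PowerSeries.C (x i ^ r) * PowerSeries.X)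
  let H : PowerSeries T := ∏ i ∈ Finset.Ici k, PowerSeries.mk fun j => (x i ^ r) ^ j
  have hE (s : Finset (Fin n)) (j : ℕ) : PowerSeries.coeff j (E s) =
      (-1) ^ j * (s.val.map fun i => x i ^ r).esymm j := by
    rw [← coeff_prod_one_sub_C_mul_X, Multiset.map_map]
    rfl
  have hE0 : PowerSeries.coeff 0 (E Finset.univ) = 1 := by
    rw [hE]; simp [Multiset.esymm]
  have hH : PowerSeries.coeff ((k : ℕ) + 1) H =
      ∑ l ∈ (Finset.Ici k).finsuppAntidiag ((k : ℕ) + 1), ∏ i ∈ Finset.Ici k, (x i ^ r) ^ l i := by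
    simp [H, PowerSeries.coeff_prod]
  have hH0 : PowerSeries.coeff 0 H = 1 := by
    simp [H, PowerSeries.coeff_prod]
  have hEH : E Finset.univ * H = E (Finset.Iio k) := by
    have h1 : E Finset.univ = E (Finset.Iio k) * E (Finset.Ici k) := by
      rw [← Finset.prod_union (Finset.disjoint_left.2 fun i h1 h2 => by
        rw [Finset.mem_Iio] at h1; rw [Finset.mem_Ici] at h2; exact absurd h1 (not_lt.2 h2))]
      congr 1
      ext i
      simpa using lt_or_ge i k
    have h2 : E (Finset.Ici k) * H = 1 := by
      rw [← Finset.prod_mul_distrib]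
      exact Finset.prod_eq_one fun i _ => one_sub_C_mul_X_mul_mk_pow _
    rw [h1, mul_assoc, h2, mul_one]
  have hzero : PowerSeries.coeff ((k : ℕ) + 1) (E Finset.univ * H) = 0 := by
    rw [hEH, hE, Multiset.esymm, Multiset.powersetCard_eq_empty _ (by simp)]
    simp
  rw [PowerSeries.coeff_mul, Finset.Nat.sum_antidiagonal_succ, hE0, one_mul, hH,
    Finset.sum_eq_single ((k : ℕ), 0)] at hzero
  · rw [eq_neg_of_add_eq_zero_left hzero, hE, hH0, pow_succ]
    simp only [powEsymm]
    ring
  · rintro ⟨i, j⟩ hij hne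
    rw [Finset.HasAntidiagonal.mem_antidiagonal] at hij
    have hlt : i + 1 ≤ (k : ℕ) := by
      rcases j with _ | j
      · exact absurd (congrArg (fun i => (i, 0)) hij) hne
      · simp only at hij
        lia
    have h0 := hx (i + 1) (Nat.succ_pos i) hlt
    rw [powEsymm] at h0
    rw [hE, h0, mul_zero, zero_mul]
  · intro h
    exact absurd (Finset.HasAntidiagonal.mem_antidiagonal.2 (add_zero _)) h

open MvPolynomial

/-- The exponents `N_k` of the leading monomials `x_k ^ N_k` in the ideal of the `f_i`. -/
def leadingExponent (r m : ℕ) {n : ℕ} (k : Fin n) : ℕ := r * (k + 1) * lastExponent n m k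

theorem leadingExponent_pos {n r m : ℕ} (hr : 0 < r) (hm : 0 < m) (k : Fin n) :
    0 < leadingExponent r m k := by
  have := lastExponent_pos hm k
  unfold leadingExponent
  positivity

theorem prod_leadingExponent {n : ℕ} (hn : 0 < n) (r m : ℕ) :
    ∏ k : Fin n, leadingExponent r m k = m * (r ^ n * n.factorial) := by
  simp only [leadingExponent, Finset.prod_mul_distrib, prod_lastExponent hn, Finset.prod_const,
    Finset.card_univ, Fintype.card_fin]
  rw [Fin.prod_univ_eq_prod_range (fun k => k + 1) n, Finset.prod_range_add_one_eq_factorial]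
  ring

theorem lt_sum_of_mem_finsuppAntidiag {n d : ℕ} {k : Fin n} {l : Fin n →₀ ℕ}
    (hl : l ∈ (Finset.Ici k).finsuppAntidiag d) (hne : l ≠ Finsupp.single k d) :
    (k : ℕ) * d < ∑ i : Fin n, (i : ℕ) * l i := by
  obtain ⟨hsum, hsupp⟩ := Finset.mem_finsuppAntidiag.1 hl
  have hsum' : ∑ i, l i = d := by
    rw [← hsum]
    refine (Finset.sum_subset (Finset.subset_univ _) fun i _ hi => ?_).symm
    by_contra h
    exact hi (hsupp (Finsupp.mem_support_iff.2 h))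
  have hle (i : Fin n) : (k : ℕ) * l i ≤ i * l i := by
    by_cases h : l i = 0
    · simp [h]
    · have : k ≤ i := Finset.mem_Ici.1 (hsupp (Finsupp.mem_support_iff.2 h))
      exact Nat.mul_le_mul_right _ this
  obtain ⟨i, hik, hi⟩ : ∃ i, i ≠ k ∧ l i ≠ 0 := by
    by_contra! h
    refine hne (Finsupp.ext fun i => ?_)
    by_cases hi : i = k
    · subst hi
      rw [Finsupp.single_eq_same, ← hsum', Finset.sum_eq_single i (fun j _ hj => h j hj) (by simp)]
    · rw [Finsupp.single_eq_of_ne hi, h i hi]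
  rw [← hsum', Finset.mul_sum]
  refine Finset.sum_lt_sum (fun i _ => hle i) ⟨i, Finset.mem_univ _, ?_⟩
  have h1 : k < i := lt_of_le_of_ne (Finset.mem_Ici.1 (hsupp (Finsupp.mem_support_iff.2 hi)))
    (Ne.symm hik)
  exact Nat.mul_lt_mul_of_pos_right h1 (Nat.pos_of_ne_zero hi)

/-- The ideal of the `f_i` contains a form with leading monomial `x_k ^ N_k` with respect to the
weights `0, 1, …, n - 1` of the variables: a complete symmetric function of
`x_k ^ r, x_{k + 1} ^ r, …` for `k` not the last index, and a power of the last variable. -/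
theorem exists_X_pow_add_mem (K : Type*) [Field K] {n r m : ℕ} (hr : 0 < r) (k : Fin n) :
    ∃ q : MvPolynomial (Fin n) K, q.IsHomogeneous (leadingExponent r m k) ∧
      (∀ a ∈ q.support, (k : ℕ) * leadingExponent r m k < ∑ i : Fin n, (i : ℕ) * a i) ∧
      X k ^ leadingExponent r m k + q ∈ Ideal.span (Set.range (esymmOfPowers K n r (r * m))) := by
  classical
  set I := Ideal.span (Set.range (esymmOfPowers K n r (r * m))) with hI
  let x : Fin n → MvPolynomial (Fin n) K ⧸ I := fun j => Ideal.Quotient.mk I (X j)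
  have hrel (i : Fin n) : powEsymm r x (i + 1) ^ lastExponent n m i = 0 := by
    rw [← map_powEsymm r (Ideal.Quotient.mk I), ← map_pow, ← esymmOfPowers_eq_pow,
      Ideal.Quotient.eq_zero_iff_mem]
    exact Ideal.subset_span ⟨i, rfl⟩
  have hlt (i : ℕ) (hi : i + 1 < n) : powEsymm r x (i + 1) = 0 := by
    simpa [lastExponent, hi] using hrel ⟨i, by lia⟩
  have key := sum_finsuppAntidiag_prod_pow_eq r x k fun i hi hik => by
    obtain ⟨i, rfl⟩ := Nat.exists_eq_add_one.2 hi
    exact hlt i (by lia)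
  have hsingle : Finsupp.single k ((k : ℕ) + 1) ∈ (Finset.Ici k).finsuppAntidiag ((k : ℕ) + 1) := by
    rw [Finset.mem_finsuppAntidiag]
    refine ⟨?_, fun i hi => ?_⟩
    · rw [Finset.sum_eq_single k (fun j _ hj => Finsupp.single_eq_of_ne hj) (by simp)]
      simp
    · rw [Finset.mem_singleton.1 (Finsupp.support_single_subset hi)]
      simp
  by_cases hk : (k : ℕ) + 1 < n
  · have hN : leadingExponent r m k = r * (k + 1) := by simp [leadingExponent, lastExponent, hk]
    rw [hlt k hk, mul_zero] at key
    refine ⟨∑ l ∈ ((Finset.Ici k).finsuppAntidiag ((k : ℕ) + 1)).erase (Finsupp.single k (k + 1)),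
      monomial (r • l) 1, ?_, ?_, ?_⟩
    · refine IsHomogeneous.sum _ _ _ fun l hl => isHomogeneous_monomial _ ?_
      obtain ⟨hsum, hsupp⟩ := Finset.mem_finsuppAntidiag.1 (Finset.mem_of_mem_erase hl)
      rw [hN, ← hsum, Finsupp.degree_eq_sum, Finset.mul_sum]
      refine (Finset.sum_subset (Finset.subset_univ _) fun i _ hi => ?_).symm
      have : l i = 0 := by
        by_contra h
        exact hi (hsupp (Finsupp.mem_support_iff.2 h))
      simp [this]
    · intro a ha
      obtain ⟨l, hl, hal⟩ := Finset.mem_biUnion.1 (support_sum ha)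
      obtain rfl := Finset.mem_singleton.1 (support_monomial_subset hal)
      have h1 := lt_sum_of_mem_finsuppAntidiag (Finset.mem_of_mem_erase hl)
        (Finset.ne_of_mem_erase hl)
      rw [hN]
      calc (k : ℕ) * (r * (k + 1)) = r * (k * (k + 1)) := by ring
        _ < r * ∑ i : Fin n, (i : ℕ) * l i := Nat.mul_lt_mul_of_pos_left h1 hr
        _ = _ := by
          rw [Finset.mul_sum]
          refine Finset.sum_congr rfl fun i _ => ?_
          rw [Finsupp.smul_apply, smul_eq_mul]
          ring
    · have h1 : (X k : MvPolynomial (Fin n) K) ^ leadingExponent r m k =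
          monomial (r • Finsupp.single k ((k : ℕ) + 1)) 1 := by
        rw [X_pow_eq_monomial, hN, Finsupp.smul_single, smul_eq_mul]
      rw [h1, Finset.add_sum_erase _ (fun l => monomial (r • l) (1 : K)) hsingle,
        ← Ideal.Quotient.eq_zero_iff_mem, map_sum, ← key]
      refine Finset.sum_congr rfl fun l hl => ?_
      rw [monomial_eq, C_1, one_mul, Finsupp.prod_fintype _ _ (fun i => pow_zero _), map_prod]
      obtain ⟨-, hsupp⟩ := Finset.mem_finsuppAntidiag.1 hl
      rw [← Finset.prod_subset (Finset.subset_univ (Finset.Ici k)) fun i _ hi => ?_]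
      · exact Finset.prod_congr rfl fun i _ => by
          rw [Finsupp.smul_apply, smul_eq_mul, map_pow, pow_mul]
      · have : l i = 0 := by
          by_contra h
          exact hi (hsupp (Finsupp.mem_support_iff.2 h))
        simp [this]
  · have hkn : (k : ℕ) + 1 = n := by lia
    refine ⟨0, isHomogeneous_zero _ _ _, by simp, ?_⟩
    rw [add_zero, ← Ideal.Quotient.eq_zero_iff_mem, map_pow]
    have hIci : Finset.Ici k = {k} := by
      ext i
      rw [Finset.mem_Ici, Finset.mem_singleton, Fin.le_def, Fin.ext_iff]
      lia
    have h1 : (x k ^ r) ^ ((k : ℕ) + 1) = (-1) ^ (k : ℕ) * powEsymm r x (k + 1) := by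
      rw [← key, Finset.sum_eq_single_of_mem _ hsingle fun l hl hne => ?_]
      · simp [hIci]
      · refine absurd (Finsupp.ext fun i => ?_) hne
        obtain ⟨hsum, hsupp⟩ := Finset.mem_finsuppAntidiag.1 hl
        rw [hIci] at hsum hsupp
        rw [Finset.sum_singleton] at hsum
        by_cases hi : i = k
        · rw [hi, hsum, Finsupp.single_eq_same]
        · rw [Finsupp.single_eq_of_ne hi]
          by_contra h
          exact hi (Finset.mem_singleton.1 (hsupp (Finsupp.mem_support_iff.2 h)))
    have h2 : leadingExponent r m k = r * (k + 1) * lastExponent n m k := rfl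
    rw [h2, pow_mul, pow_mul]
    change ((x k ^ r) ^ ((k : ℕ) + 1)) ^ _ = 0
    rw [h1, mul_pow, hrel, mul_zero]

end LeadingForms

/-! ### Degeneration to a monomial ideal -/

section Degeneration

open MvPolynomial

variable {K σ : Type*} [Field K] [Fintype σ]

/-- Being spanned by a polynomial family of forms of degree `d` is an open condition on the
parameter: if the family specializes at `0` to the monomials of degree `d`, then its
specializations at all `μ` outside the zero set of a nonzero polynomial span the forms of
degree `d`. -/
theorem exists_forall_homogeneousSubmodule_le {d : ℕ}
    (W : (σ →₀ ℕ) → MvPolynomial σ (Polynomial K))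
    (hhom : ∀ a, a.degree = d → (W a).IsHomogeneous d)
    (h0 : ∀ a, a.degree = d → map (Polynomial.evalRingHom 0) (W a) = monomial a 1) :
    ∃ q : Polynomial K, q ≠ 0 ∧ ∀ μ, q.eval μ ≠ 0 → ∀ U : Submodule K (MvPolynomial σ K),
      (∀ a, a.degree = d → map (Polynomial.evalRingHom μ) (W a) ∈ U) →
      homogeneousSubmodule σ K d ≤ U := by
  classical
  have hfin : Finite {a : σ →₀ ℕ // a.degree = d} := by
    refine (Set.Finite.subset (Finsupp.finite_of_degree_le d) ?_).to_subtype
    intro a ha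
    exact (show a.degree = d from ha).le
  have := Fintype.ofFinite {a : σ →₀ ℕ // a.degree = d}
  let M : Matrix {a : σ →₀ ℕ // a.degree = d} {a : σ →₀ ℕ // a.degree = d} (Polynomial K) :=
    fun a b => coeff b.1 (W a.1)
  have hM (μ : K) (a b) : (M.map (Polynomial.evalRingHom μ)) a b =
      coeff b.1 (map (Polynomial.evalRingHom μ) (W a.1)) := by
    rw [coeff_map]; rfl
  have hdet (μ : K) : M.det.eval μ = (M.map (Polynomial.evalRingHom μ)).det :=
    RingHom.map_det (Polynomial.evalRingHom μ) M
  -- the matrix of coefficients of the family is the identity at `0`, so its determinant is nonzero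
  refine ⟨M.det, ?_, fun μ hμ U hU => ?_⟩
  · intro h
    have h1 := hdet 0
    have h2 : M.map (Polynomial.evalRingHom 0) = 1 := by
      ext a b
      rw [hM, h0 _ a.2, coeff_monomial, Matrix.one_apply]
      simp only [Subtype.ext_iff]
    rw [h, h2, Matrix.det_one, Polynomial.eval_zero] at h1
    exact zero_ne_one h1
  · let A := M.map (Polynomial.evalRingHom μ)
    have hA : A⁻¹ * A = 1 := Matrix.nonsing_inv_mul _ ((hdet μ ▸ hμ).isUnit)
    have hmon (b : σ →₀ ℕ) (hb : b.degree = d) : monomial b (1 : K) ∈ U := by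
      have h1 : monomial b (1 : K) =
          ∑ a, A⁻¹ ⟨b, hb⟩ a • map (Polynomial.evalRingHom μ) (W a.1) := by
        ext e
        rw [coeff_sum]
        by_cases he : e.degree = d
        · have h2 := congrFun (congrFun hA ⟨b, hb⟩) ⟨e, he⟩
          rw [Matrix.mul_apply, Matrix.one_apply] at h2
          rw [coeff_monomial]
          simp only [Subtype.mk.injEq] at h2
          rw [← h2]
          refine Finset.sum_congr rfl fun a _ => ?_
          rw [coeff_smul, smul_eq_mul]
          exact congrArg _ (hM μ a ⟨e, he⟩)
        · rw [coeff_monomial, if_neg (by rintro rfl; exact he hb)]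
          refine (Finset.sum_eq_zero fun a _ => ?_).symm
          rw [coeff_smul, ((hhom _ a.2).map _).coeff_eq_zero he, smul_zero]
      rw [h1]
      exact Submodule.sum_mem _ fun a _ => U.smul_mem _ (hU _ a.2)
    intro p hp
    rw [p.as_sum]
    refine Submodule.sum_mem _ fun a ha => ?_
    have h1 := U.smul_mem (coeff a p) (hmon a (degree_eq_of_mem_support hp ha))
    rwa [smul_monomial, smul_eq_mul, mul_one] at h1

/-- The substitution `x_i ↦ t ^ (w_i) x_i`. -/
noncomputable def weightedScale (w : σ → ℕ) (t : K) : MvPolynomial σ K →ₐ[K] MvPolynomial σ K :=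
  aeval fun i => C (t ^ w i) * X i

theorem weightedScale_monomial (w : σ → ℕ) (t : K) (a : σ →₀ ℕ) (c : K) :
    weightedScale w t (monomial a c) = monomial a (t ^ (∑ i, w i * a i) * c) := by
  rw [weightedScale, aeval_monomial, Finsupp.prod_fintype _ _ (fun i => pow_zero _),
    monomial_eq, Finsupp.prod_fintype _ _ (fun i => pow_zero _)]
  simp only [mul_pow, Finset.prod_mul_distrib, ← map_pow, ← pow_mul, Finset.prod_pow_eq_pow_sum,
    ← map_prod, MvPolynomial.algebraMap_eq, C_mul]
  ring

theorem isHomogeneous_weightedScale (w : σ → ℕ) (t : K) {d : ℕ} {p : MvPolynomial σ K}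
    (hp : p.IsHomogeneous d) : (weightedScale w t p).IsHomogeneous d := by
  rw [p.as_sum, map_sum]
  refine IsHomogeneous.sum _ _ _ fun a ha => ?_
  rw [weightedScale_monomial]
  exact isHomogeneous_monomial _ (degree_eq_of_mem_support hp ha)

theorem homogeneousSubmodule_le_of_le_comap_weightedScale {w : σ → ℕ} {t : K} (ht : t ≠ 0) {d : ℕ}
    {V : Submodule K (MvPolynomial σ K)}
    (hV : homogeneousSubmodule σ K d ≤ V.comap (weightedScale w t).toLinearMap) :
    homogeneousSubmodule σ K d ≤ V := by
  intro p hp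
  rw [p.as_sum]
  refine Submodule.sum_mem _ fun a ha => ?_
  have h1 := hV (isHomogeneous_monomial ((t ^ (∑ i, w i * a i))⁻¹ * coeff a p)
    (degree_eq_of_mem_support hp ha))
  rw [Submodule.mem_comap, AlgHom.toLinearMap_apply, weightedScale_monomial,
    mul_inv_cancel_left₀ (pow_ne_zero _ ht)] at h1
  exact h1

/-- A form `x_k ^ N + q`, all of whose other monomials have larger weight, is deformed to its
leading monomial: the parameter `0` gives `x_k ^ N`, and a parameter `μ ≠ 0` gives the original
form up to a scalar and a scaling of the variables. -/
theorem exists_deformation {w : σ → ℕ} {k : σ} {N : ℕ} {q : MvPolynomial σ K}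
    (hq : q.IsHomogeneous N) (hw : ∀ a ∈ q.support, w k * N < ∑ i, w i * a i) :
    ∃ P : MvPolynomial σ (Polynomial K), P.IsHomogeneous N ∧
      map (Polynomial.evalRingHom 0) P = X k ^ N ∧
      ∀ μ, μ ≠ 0 → weightedScale w μ⁻¹ (map (Polynomial.evalRingHom μ) P) =
        C (μ⁻¹ ^ (w k * N)) * (X k ^ N + q) := by
  classical
  refine ⟨X k ^ N + ∑ a ∈ q.support, monomial a
    (Polynomial.C (coeff a q) * Polynomial.X ^ (∑ i, w i * a i - w k * N)), ?_, ?_, ?_⟩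
  · exact (isHomogeneous_X_pow k N).add (IsHomogeneous.sum _ _ _ fun a ha =>
      isHomogeneous_monomial _ (degree_eq_of_mem_support hq ha))
  · rw [map_add, map_pow, map_X, map_sum, Finset.sum_eq_zero, add_zero]
    intro a ha
    rw [map_monomial, map_mul, map_pow, Polynomial.coe_evalRingHom, Polynomial.eval_X,
      zero_pow (Nat.sub_pos_of_lt (hw a ha)).ne', mul_zero, monomial_zero]
  · intro μ hμ
    rw [map_add, map_pow, map_X, map_sum, map_add, map_sum, mul_add]
    congr 1
    · rw [X_pow_eq_monomial, weightedScale_monomial, C_mul_monomial]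
      simp [Finsupp.single_apply]
    · conv_rhs => rw [q.as_sum, Finset.mul_sum]
      refine Finset.sum_congr rfl fun a ha => ?_
      rw [map_monomial, weightedScale_monomial, C_mul_monomial]
      congr 1
      obtain ⟨e, he⟩ := Nat.exists_eq_add_of_lt (hw a ha)
      rw [he, show w k * N + e + 1 - w k * N = e + 1 by lia, add_assoc, pow_add]
      simp only [map_mul, map_pow, Polynomial.coe_evalRingHom, Polynomial.eval_X,
        Polynomial.eval_C]
      rw [mul_comm (coeff a q), mul_assoc, ← mul_assoc (μ⁻¹ ^ (e + 1)), ← mul_pow,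
        inv_mul_cancel₀ hμ, one_pow, one_mul]

/-- An ideal contains forms with leading monomials `x_k ^ N_k`, with respect to the weights `w`
of the variables, the leading monomial being the one of smallest weight. -/
def HasLeadingPowers (I : Ideal (MvPolynomial σ K)) (w N : σ → ℕ) : Prop :=
  ∀ k, ∃ q : MvPolynomial σ K, q.IsHomogeneous (N k) ∧
    (∀ a ∈ q.support, w k * N k < ∑ i, w i * a i) ∧ X k ^ N k + q ∈ I

/-- Forms in the monomial ideal `(x_k ^ N_k)` deform to elements of `I`. -/
theorem HasLeadingPowers.exists_deformation {I : Ideal (MvPolynomial σ K)} {w N : σ → ℕ}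
    (hI : HasLeadingPowers I w N) {d : ℕ} {g : MvPolynomial σ K} (hg : g.IsHomogeneous d)
    (hgJ : g ∈ Ideal.span (Set.range fun k => (X k : MvPolynomial σ K) ^ N k)) :
    ∃ Q : MvPolynomial σ (Polynomial K), Q.IsHomogeneous d ∧
      map (Polynomial.evalRingHom 0) Q = g ∧
      ∀ μ, μ ≠ 0 → weightedScale w μ⁻¹ (map (Polynomial.evalRingHom μ) Q) ∈ I := by
  classical
  choose q hq hqw hqI using hI
  choose P hP hP0 hPμ using fun k => _root_.exists_deformation (hq k) (hqw k)
  rw [mem_span_range_X_pow_iff] at hgJ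
  rcases eq_or_ne g 0 with rfl | hg0
  · exact ⟨0, isHomogeneous_zero _ _ _, map_zero _, fun μ _ => by simp⟩
  have : Nonempty σ := by
    obtain ⟨b, hb⟩ := support_nonempty.2 hg0
    exact (hgJ b hb).nonempty
  choose! k hk using hgJ
  refine ⟨∑ b ∈ g.support, monomial (b - Finsupp.single (k b) (N (k b)))
    (Polynomial.C (coeff b g)) * P (k b), ?_, ?_, ?_⟩
  · refine IsHomogeneous.sum _ _ _ fun b hb => ?_
    have hle : Finsupp.single (k b) (N (k b)) ≤ b := Finsupp.single_le_iff.2 (hk b hb)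
    have hd : d = (b - Finsupp.single (k b) (N (k b))).degree + N (k b) := by
      rw [← degree_eq_of_mem_support hg hb]
      conv_lhs => rw [← tsub_add_cancel_of_le hle, map_add, Finsupp.degree_single]
    rw [hd]
    exact (isHomogeneous_monomial _ rfl).mul (hP _)
  · rw [map_sum]
    conv_rhs => rw [g.as_sum]
    refine Finset.sum_congr rfl fun b hb => ?_
    have hle : Finsupp.single (k b) (N (k b)) ≤ b := Finsupp.single_le_iff.2 (hk b hb)
    rw [map_mul, hP0, map_monomial, X_pow_eq_monomial, monomial_mul, tsub_add_cancel_of_le hle]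
    simp
  · intro μ hμ
    rw [map_sum, map_sum]
    refine Ideal.sum_mem _ fun b _ => ?_
    rw [map_mul, map_mul, hPμ _ μ hμ]
    exact I.mul_mem_left _ (I.mul_mem_left _ (hqI _))

/-- Modulo `I`, every form is a combination of the monomials `x ^ a` with `a_k < N_k`. -/
theorem HasLeadingPowers.homogeneousSubmodule_le [Infinite K] {I : Ideal (MvPolynomial σ K)}
    {w N : σ → ℕ} (hI : HasLeadingPowers I w N) (d : ℕ) :
    homogeneousSubmodule σ K d ≤ I.restrictScalars K ⊔ Submodule.span K
      {p | ∃ a : σ →₀ ℕ, a.degree = d ∧ (∀ k, a k < N k) ∧ p = monomial a 1} := by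
  classical
  set V := I.restrictScalars K ⊔ Submodule.span K
      {p | ∃ a : σ →₀ ℕ, a.degree = d ∧ (∀ k, a k < N k) ∧ p = monomial a (1 : K)} with hV
  have key (a : σ →₀ ℕ) : ∃ Q : MvPolynomial σ (Polynomial K), a.degree = d →
      Q.IsHomogeneous d ∧ map (Polynomial.evalRingHom 0) Q = monomial a 1 ∧
      ∀ μ, μ ≠ 0 → weightedScale w μ⁻¹ (map (Polynomial.evalRingHom μ) Q) ∈ V := by
    by_cases ha : ∀ k, a k < N k
    · refine ⟨monomial a 1, fun had => ⟨isHomogeneous_monomial _ had, by simp, fun μ _ => ?_⟩⟩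
      rw [map_monomial, map_one, weightedScale_monomial, ← smul_eq_mul, ← smul_monomial]
      exact V.smul_mem _ (Submodule.mem_sup_right (Submodule.subset_span ⟨a, had, ha, rfl⟩))
    · push Not at ha
      by_cases had : a.degree = d
      · obtain ⟨Q, h1, h2, h3⟩ := hI.exists_deformation (isHomogeneous_monomial (1 : K) had) (by
          rw [mem_span_range_X_pow_iff]
          intro b hb
          rwa [Finset.mem_singleton.1 (support_monomial_subset hb)])
        exact ⟨Q, fun _ => ⟨h1, h2, fun μ hμ => Submodule.mem_sup_left (h3 μ hμ)⟩⟩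
      · exact ⟨0, fun h => absurd h had⟩
  choose W hW using key
  obtain ⟨q, hq0, hq⟩ := exists_forall_homogeneousSubmodule_le W (fun a ha => (hW a ha).1)
    (fun a ha => (hW a ha).2.1)
  -- the factor `X` ensures `μ ≠ 0`
  obtain ⟨μ, hμ⟩ : ∃ μ, (q * Polynomial.X).eval μ ≠ 0 := by
    by_contra! h
    exact mul_ne_zero hq0 Polynomial.X_ne_zero (Polynomial.funext fun μ => by simpa using h μ)
  rw [Polynomial.eval_mul, Polynomial.eval_X] at hμ
  have hμ0 : μ ≠ 0 := right_ne_zero_of_mul hμ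
  refine homogeneousSubmodule_le_of_le_comap_weightedScale (w := w) (inv_ne_zero hμ0) ?_
  exact hq μ (left_ne_zero_of_mul hμ) _ fun a ha => (hW a ha).2.2 μ hμ0

/-- The surjectivity part of the strong Lefschetz property passes from the monomial ideal
`(x_k ^ N_k)` to `I`, the linear form being a generic rescaling of `∑ x_k`. -/
theorem HasLeadingPowers.exists_linear_form [CharZero K] {I : Ideal (MvPolynomial σ K)}
    {w N : σ → ℕ} (hI : HasLeadingPowers I w N) (hN : ∀ k, 0 < N k) {c : ℕ}
    (hc : ∑ k, (N k - 1) = c) :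
    ∃ L : MvPolynomial σ K, L.IsHomogeneous 1 ∧ ∀ i, 2 * i ≤ c →
      ∀ p : MvPolynomial σ K, p.IsHomogeneous (c - i) →
        ∃ u : MvPolynomial σ K, u.IsHomogeneous i ∧ p - L ^ (c - 2 * i) * u ∈ I := by
  classical
  let ℓ : MvPolynomial σ K := ∑ k, X k
  have hℓ : ℓ.IsHomogeneous 1 := IsHomogeneous.sum _ _ 1 fun k _ => isHomogeneous_X K k
  let V (i : ℕ) (μ : K) : Submodule K (MvPolynomial σ K) := I.restrictScalars K ⊔
    (homogeneousSubmodule σ K i).map (LinearMap.mulLeft K (weightedScale w μ⁻¹ ℓ ^ (c - 2 * i)))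
  have key (i : ℕ) (a : σ →₀ ℕ) : ∃ Q : MvPolynomial σ (Polynomial K), 2 * i ≤ c →
      a.degree = c - i → Q.IsHomogeneous (c - i) ∧
      map (Polynomial.evalRingHom 0) Q = monomial a 1 ∧
      ∀ μ, μ ≠ 0 → weightedScale w μ⁻¹ (map (Polynomial.evalRingHom μ) Q) ∈ V i μ := by
    by_cases h : 2 * i ≤ c ∧ a.degree = c - i
    · obtain ⟨hi, had⟩ := h
      have hmon := isHomogeneous_monomial (1 : K) had
      obtain ⟨u, hu, huJ⟩ := exists_sub_sum_X_pow_mul_mem hN hc hi hmon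
      have hhom : (ℓ ^ (c - 2 * i) * u).IsHomogeneous (c - i) := by
        have h1 := (hℓ.pow (c - 2 * i)).mul hu
        rwa [one_mul, show c - 2 * i + i = c - i by lia] at h1
      obtain ⟨Q, h1, h2, h3⟩ := hI.exists_deformation (hmon.sub hhom) huJ
      have hmap (μ : K) : map (Polynomial.evalRingHom μ)
          (map Polynomial.C (ℓ ^ (c - 2 * i) * u)) = ℓ ^ (c - 2 * i) * u := by
        rw [map_map, show (Polynomial.evalRingHom μ).comp Polynomial.C = RingHom.id K by
          ext x; simp, MvPolynomial.map_id]
      refine ⟨Q + map Polynomial.C (ℓ ^ (c - 2 * i) * u), fun _ _ =>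
        ⟨h1.add (hhom.map _), ?_, fun μ hμ => ?_⟩⟩
      · rw [map_add, h2, hmap, sub_add_cancel]
      · rw [map_add, hmap, map_add, map_mul, map_pow]
        refine add_mem (Submodule.mem_sup_left (h3 μ hμ)) (Submodule.mem_sup_right ?_)
        exact ⟨_, isHomogeneous_weightedScale w _ hu, rfl⟩
    · exact ⟨0, fun h1 h2 => absurd ⟨h1, h2⟩ h⟩
  -- one parameter `μ` has to serve all degrees `i`, whence the product of the `q i` below
  choose W hW using key
  have key2 (i : ℕ) : ∃ q : Polynomial K, q ≠ 0 ∧ (2 * i ≤ c → ∀ μ, q.eval μ ≠ 0 → μ ≠ 0 →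
      homogeneousSubmodule σ K (c - i) ≤ V i μ) := by
    by_cases hi : 2 * i ≤ c
    · obtain ⟨q, hq0, hq⟩ := exists_forall_homogeneousSubmodule_le (W i)
        (fun a ha => (hW i a hi ha).1) (fun a ha => (hW i a hi ha).2.1)
      refine ⟨q, hq0, fun _ μ hμ hμ0 => ?_⟩
      refine homogeneousSubmodule_le_of_le_comap_weightedScale (w := w) (inv_ne_zero hμ0) ?_
      exact hq μ hμ _ fun a ha => (hW i a hi ha).2.2 μ hμ0
    · exact ⟨1, one_ne_zero, fun h => absurd h hi⟩
  choose q hq0 hq using key2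
  obtain ⟨μ, hμ⟩ : ∃ μ, ((∏ i ∈ Finset.range (c + 1), q i) * Polynomial.X).eval μ ≠ 0 := by
    by_contra! h
    exact mul_ne_zero (Finset.prod_ne_zero_iff.2 fun i _ => hq0 i) Polynomial.X_ne_zero
      (Polynomial.funext fun μ => by simpa using h μ)
  rw [Polynomial.eval_mul, Polynomial.eval_X, Polynomial.eval_prod] at hμ
  have hμ0 : μ ≠ 0 := right_ne_zero_of_mul hμ
  refine ⟨weightedScale w μ⁻¹ ℓ, isHomogeneous_weightedScale w _ hℓ, fun i hi p hp => ?_⟩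
  have hμi : (q i).eval μ ≠ 0 :=
    Finset.prod_ne_zero_iff.1 (left_ne_zero_of_mul hμ) i (Finset.mem_range.2 (by lia))
  obtain ⟨y, hy, _, ⟨u, hu, rfl⟩, rfl⟩ := Submodule.mem_sup.1 (hq i hi μ hμi hμ0 hp)
  refine ⟨u, hu, ?_⟩
  rw [LinearMap.mulLeft_apply, add_sub_cancel_right]
  exact hy

end Degeneration

/-! ### The strong Lefschetz property -/

section StrongLefschetz

open MvPolynomial

variable {K σ : Type*} [Field K] [Fintype σ]

/-- The monomial `x ^ a` with `a_k < N_k`. -/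
noncomputable def standardMonomial (K : Type*) {σ : Type*} [Field K] [Fintype σ] {N : σ → ℕ}
    (a : ∀ k, Fin (N k)) : MvPolynomial σ K :=
  monomial (Finsupp.equivFunOnFinite.symm fun k => (a k : ℕ)) 1

theorem isHomogeneous_standardMonomial {N : σ → ℕ} (a : ∀ k, Fin (N k)) :
    (standardMonomial K a).IsHomogeneous (∑ k, (a k : ℕ)) :=
  isHomogeneous_monomial _ (by simp [Finsupp.degree_eq_sum])

/-- The monomials `x ^ a`, `a_k < N_k`, of degrees `i` and `c - i` are equinumerous. -/
theorem card_filter_sum_eq {N : σ → ℕ} {c i : ℕ}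
    (hc : ∑ k, (N k - 1) = c) (hi : i ≤ c) [DecidableEq σ] :
    (Finset.univ.filter fun a : ∀ k, Fin (N k) => ∑ k, (a k : ℕ) = i).card =
      (Finset.univ.filter fun a : ∀ k, Fin (N k) => ∑ k, (a k : ℕ) = c - i).card := by
  have hrev (a : ∀ k, Fin (N k)) : ∑ k, ((a k).rev : ℕ) + ∑ k, (a k : ℕ) = c := by
    rw [← hc, ← Finset.sum_add_distrib]
    refine Finset.sum_congr rfl fun k _ => ?_
    rw [Fin.val_rev]
    have := (a k).2
    lia
  refine Finset.card_nbij' (fun a k => (a k).rev) (fun a k => (a k).rev) ?_ ?_ ?_ ?_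
  · intro a ha
    have := hrev a
    simp only [Finset.coe_filter, Finset.mem_univ, true_and, Set.mem_ofPred_eq] at ha ⊢
    lia
  · intro a ha
    have := hrev a
    simp only [Finset.coe_filter, Finset.mem_univ, true_and, Set.mem_ofPred_eq] at ha ⊢
    lia
  · intro a _
    simp
  · intro a _
    simp

variable {n : ℕ} {I : Ideal (MvPolynomial (Fin n) K)} {w N : Fin n → ℕ}

theorem HasLeadingPowers.quotientGrading_eq [Infinite K] (hI : HasLeadingPowers I w N) (d : ℕ) :
    quotientGrading I d = Submodule.span K ((fun a : ∀ k, Fin (N k) =>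
      Ideal.Quotient.mk I (standardMonomial K a)) '' {a | ∑ k, (a k : ℕ) = d}) := by
  apply le_antisymm
  · rintro _ ⟨p, hp, rfl⟩
    obtain ⟨y, hy, z, hz, rfl⟩ := Submodule.mem_sup.1 (hI.homogeneousSubmodule_le d hp)
    have h1 : Ideal.Quotient.mk I y = 0 := Ideal.Quotient.eq_zero_iff_mem.2 hy
    rw [map_add]
    change Ideal.Quotient.mk I y + (Ideal.Quotient.mkₐ K I).toLinearMap z ∈ _
    rw [h1, zero_add]
    have h2 := Submodule.mem_map_of_mem (f := (Ideal.Quotient.mkₐ K I).toLinearMap) hz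
    rw [Submodule.map_span] at h2
    refine Submodule.span_mono ?_ h2
    rintro _ ⟨_, ⟨a, had, ha, rfl⟩, rfl⟩
    refine ⟨fun k => ⟨a k, ha k⟩, ?_, ?_⟩
    · rw [Finsupp.degree_eq_sum] at had
      exact had
    · have h3 : Finsupp.equivFunOnFinite.symm (fun k => a k) = a := by
        ext k
        simp
      change Ideal.Quotient.mk I (monomial (Finsupp.equivFunOnFinite.symm fun k => a k) 1) = _
      rw [h3]
      rfl
  · rw [Submodule.span_le]
    rintro _ ⟨a, rfl, rfl⟩
    exact ⟨_, isHomogeneous_standardMonomial a, rfl⟩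

/-- The standard monomials span, and by counting they form a basis. -/
theorem HasLeadingPowers.linearIndependent [Infinite K] (hI : HasLeadingPowers I w N)
    (hfin : Module.finrank K (MvPolynomial (Fin n) K ⧸ I) = ∏ k, N k) :
    LinearIndependent K fun a : ∀ k, Fin (N k) =>
      Ideal.Quotient.mk I (standardMonomial K a) := by
  refine linearIndependent_of_top_le_span_of_card_eq_finrank ?_ (by simp [hfin])
  rintro p -
  obtain ⟨p, rfl⟩ := Ideal.Quotient.mk_surjective p
  rw [← sum_homogeneousComponent p, map_sum]
  refine Submodule.sum_mem _ fun d _ => ?_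
  have h1 : Ideal.Quotient.mk I (homogeneousComponent d p) ∈ quotientGrading I d :=
    ⟨_, homogeneousComponent_isHomogeneous d p, rfl⟩
  rw [hI.quotientGrading_eq] at h1
  exact Submodule.span_mono (Set.image_subset_range _ _) h1

/-- An ideal `I` with leading powers `x_k ^ N_k` and with a quotient of dimension `∏ N_k` is a flat
deformation of the monomial complete intersection `(x_k ^ N_k)`, and inherits the strong
Lefschetz property from it. -/
theorem HasLeadingPowers.hasSLP [CharZero K] (hI : HasLeadingPowers I w N) (hN : ∀ k, 0 < N k)
    (hfin : Module.finrank K (MvPolynomial (Fin n) K ⧸ I) = ∏ k, N k) :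
    HasSLP (quotientGrading I) := by
  classical
  obtain ⟨c, hc⟩ : ∃ c, ∑ k, (N k - 1) = c := ⟨_, rfl⟩
  have hli := hI.linearIndependent hfin
  have hfinite (d : ℕ) : FiniteDimensional K (quotientGrading I d) := by
    rw [hI.quotientGrading_eq]
    exact FiniteDimensional.span_of_finite K (Set.toFinite _)
  have hrank (d : ℕ) : Module.finrank K (quotientGrading I d) =
      (Finset.univ.filter fun a : ∀ k, Fin (N k) => ∑ k, (a k : ℕ) = d).card := by
    have h1 := finrank_span_eq_card (hli.comp
      (Subtype.val : {a : ∀ k, Fin (N k) // ∑ k, (a k : ℕ) = d} → _) Subtype.val_injective)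
    rw [Set.range_comp, Subtype.range_coe_subtype] at h1
    rw [hI.quotientGrading_eq, h1, Fintype.card_subtype]
  have hle (a : ∀ k, Fin (N k)) : ∑ k, (a k : ℕ) ≤ c := by
    rw [← hc]
    exact Finset.sum_le_sum fun k _ => Nat.le_sub_one_of_lt (a k).2
  obtain ⟨L, hL, hsurj⟩ := hI.exists_linear_form hN hc
  refine ⟨c, ?_, fun d hd => ?_, Ideal.Quotient.mk I L, ⟨L, hL, rfl⟩, fun i hi => ?_⟩
  · let a : ∀ k, Fin (N k) := fun k => ⟨N k - 1, Nat.sub_one_lt (hN k).ne'⟩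
    refine (Submodule.ne_bot_iff _).2 ⟨Ideal.Quotient.mk I (standardMonomial K a), ?_, hli.ne_zero a⟩
    rw [hI.quotientGrading_eq]
    exact Submodule.subset_span ⟨a, hc, rfl⟩
  · rw [hI.quotientGrading_eq, Submodule.span_eq_bot]
    rintro _ ⟨a, ha, rfl⟩
    exact absurd (hle a) (not_le.2 (ha ▸ hd))
  · set e := c - 2 * i with he
    let g := Ideal.Quotient.mk I L
    have hmaps : ∀ x ∈ quotientGrading I i, LinearMap.mulLeft K (g ^ e) x ∈
        quotientGrading I (c - i) := by
      rintro _ ⟨p, hp, rfl⟩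
      refine ⟨L ^ e * p, ?_, by simp [g]⟩
      have h1 := (hL.pow e).mul hp
      rwa [one_mul, show e + i = c - i by lia] at h1
    let φ := (LinearMap.mulLeft K (g ^ e)).restrict hmaps
    have hφsurj : Function.Surjective φ := by
      rintro ⟨_, p, hp, rfl⟩
      obtain ⟨u, hu, hpu⟩ := hsurj i hi p hp
      refine ⟨⟨Ideal.Quotient.mk I u, u, hu, rfl⟩, Subtype.ext ?_⟩
      change g ^ e * Ideal.Quotient.mk I u = Ideal.Quotient.mk I p
      rw [← map_pow, ← map_mul, eq_comm, Ideal.Quotient.eq]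
      exact hpu
    have hφinj : Function.Injective φ := by
      refine (LinearMap.injective_iff_surjective_of_finrank_eq_finrank ?_).2 hφsurj
      rw [hrank, hrank, card_filter_sum_eq hc (by lia)]
    refine ⟨hmaps, fun x hx y hy hxy => ?_, fun y hy => ?_⟩
    · have h1 : φ ⟨x, hx⟩ = φ ⟨y, hy⟩ := Subtype.ext hxy
      exact congrArg Subtype.val (hφinj h1)
    · obtain ⟨⟨x, hx⟩, hxy⟩ := hφsurj ⟨y, hy⟩
      exact ⟨x, hx, congrArg Subtype.val hxy⟩

end StrongLefschetz

theorem mainTheorem9 {K : Type*} [Field K] [CharZero K] (n r s : ℕ) (hn : 0 < n) (hr : 0 < r)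
    (hs : 0 < s) (hrs : r ∣ s) :
    RingTheory.Sequence.IsRegular (MvPolynomial (Fin n) K) (List.ofFn (esymmOfPowers K n r s)) ∧
    Module.Finite K
      (MvPolynomial (Fin n) K ⧸ Ideal.span (Set.range (esymmOfPowers K n r s))) ∧
    HasSLP (quotientGrading (Ideal.span (Set.range (esymmOfPowers K n r s)))) := by
  obtain ⟨m, rfl⟩ := hrs
  have hm : 0 < m := Nat.pos_of_mul_pos_left hs
  obtain ⟨b⟩ := nonempty_basis_quotient_esymmOfPowers K hn hr hm
  refine ⟨isRegular_esymmOfPowers K hr hm, Module.Finite.of_basis b, ?_⟩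
  have hI : HasLeadingPowers (Ideal.span (Set.range (esymmOfPowers K n r (r * m))))
      (fun i : Fin n => (i : ℕ)) (leadingExponent r m) := fun k => exists_X_pow_add_mem K hr k
  refine hI.hasSLP (leadingExponent_pos hr hm) ?_
  rw [Module.finrank_eq_card_basis b, Fintype.card_fin, prod_leadingExponent hn]
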